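/- **Setting.** Let $R$ (robots) and $P$ (targets) be finite sets with $|R|=|P|=r$. Robot $i$ is given a set $P^i\subseteq P$ and costs $c^i:P^i\to\mathbb R$. Put $w(i,j)=c^i(j)$ if $j\in P^i$ and $w(i,j)=\mathfrak M$ otherwise, where $\mathfrak M\in\mathbb R$ is fixed; robot $i$ initially knows only $R$, $P$ and $w(i,\cdot)$. For every $t\in\mathbb R_{\ge0}$ let $\mathcal G_c(t)$ be a strongly connected digraph on $R$, and let $t_0<t_1<\dots$ be the instants at which the robots communicate. **Subroutines.** For $E_y\subseteq R\times P$ let $(M,V_c)$, $V_c=(R_c,P_c)$, be a maximum cardinality matching of $E_y$ and the minimum vertex cover that König's construction obtains from it by alternating paths, started from the unmatched targets (or, in all calls, from the unmatched robots). A fixed deterministic routine, the same for all robots, computes $(M,V_c)$ from $E_y$. A fixed pruning routine replaces $E_y$ by a subset for which the first routine returns the same $(M,V_c)$. For labels $y:R\cup P\to\mathbb R$ let the slack of $(i,j)$ be $w(i,j)-y(i)-y(j)$. If robot $i\notin R_c$ and $P\setminus P_c\ne\emptyset$, the *best edge* of $i$ is $(i,j^\star)$ with $j^\star\in P\setminus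 P_c$ of minimum slack, ties being broken by a fixed rule depending on $i$, $y$, $P_c$; otherwise there is none. **Distributed-Hungarian algorithm.** The state of a robot consists of edge sets $E_y$, $E_{cand}$ with the weights of their edges, labels $y$ and a counter $\gamma\in\mathbb Z$. At $t_0$ robot $i$ chooses $j^\star$ minimizing $w(i,\cdot)$ and sets $E_y=\{(i,j^\star)\}$, $E_{cand}=\emptyset$, $y(i)=w(i,j^\star)$, all other labels $0$, $\gamma=-1$. At every $t_k$ each robot $i$ receives the states of its in-neighbors in $\mathcal G_c(t_k)$ and, from these and its own, forms a temporary state: * if all these counters are $-1$: $E_y$ is the union of the sets $E_y$, $E_{cand}=\emptyset$, $y$ is the edge weight at each robot with an edge in $E_y$ and $0$ elsewhere, and $\gamma=0$ if $|E_y|=r$, $\gamma=-1$ otherwise; * if not: $\gamma,y,E_y$ are copied from any one robot with the highest counter, and $E_{cand}$ is the union of the sets $E_{cand}$ of all robots with the highest counter. If the temporary $\gamma$ is $-1$, or the matching $M$ computed from the temporary $E_y$ is perfect, the temporary state is the new state. Otherwise robot $i$ adds its best edge (if any) to $E_{cand}$. If then $|E_{cand}|\ne|R\setminus R_c|$, this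 is its new state. If $|E_{cand}|=|R\setminus R_c|$, it lets $\delta$ be the minimum slack over $E_{cand}$, subtracts $\delta$ from $y$ on $R_c$, adds $\delta$ to $y$ on $P\setminus P_c$, replaces $E_y$ by the edges of $E_y\cup E_{cand}$ of slack $0$, recomputes $(M,V_c)$, lets $E_{cand}$ consist of its best edge for the new data (if any), prunes $E_y$, and increases $\gamma$ by $1$. The assignment held by a robot is the matching $M$ computed from its current $E_y$. **Theorem.** For every choice of such routines and every execution of the algorithm there are a finite time $T_f\in\{t_0,t_1,\dots\}$ and a matching $\hat M$ such that at every $t_k\ge T_f$ all robots hold the assignment $\hat M$, and $\hat M$ is a minimum-weight perfect matching of the complete bipartite graph on $(R,P)$ with weights $w$. If moreover the graph with edge set $E=\{(i,j): j\in P^i\}$ has a perfect matching and $\mathfrak M$ is prohibitively large (each perfect matching of the complete graph that is not contained in $E$ weighs more than each perfect matching contained in $E$), then $\hat M$ is a minimum-weight perfect matching of the graph with edge set $E$ and weights $c^i(j)$. -/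

import Mathlib

open scoped NNReal

namespace DistributedHungarian

/-! ### Bipartite graphs, matchings, vertex covers

Robots form a finite type `R`, targets a finite type `P`, and a set of edges of a bipartite graph
with bipartition `(R, P)` is a `Finset (R × P)`. -/

section Bipartite

/-- A set of edges without common vertices. -/
def IsMatching {R P : Type*} (M : Finset (R × P)) : Prop :=
  ∀ e ∈ M, ∀ f ∈ M, (e.1 = f.1 ∨ e.2 = f.2) → e = f

/-- A matching that covers every robot and every target. -/
def IsPerfectMatching {R P : Type*} (M : Finset (R × P)) : Prop :=
  IsMatching M ∧ (∀ i : R, ∃ j : P, (i, j) ∈ M) ∧ (∀ j : P, ∃ i : R, (i, j) ∈ M)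

/-- A matching inside `E` with the largest possible number of edges. -/
def IsMaximumMatching {R P : Type*} (E M : Finset (R × P)) : Prop :=
  M ⊆ E ∧ IsMatching M ∧ ∀ M' : Finset (R × P), M' ⊆ E → IsMatching M' → M'.card ≤ M.card

/-- A perfect matching of the graph with edge set `E` of least total weight. -/
def IsMinWeightPerfectMatching {R P : Type*} (E : Finset (R × P)) (w : R × P → ℝ)
    (M : Finset (R × P)) : Prop :=
  M ⊆ E ∧ IsPerfectMatching M ∧
    ∀ M' : Finset (R × P), M' ⊆ E → IsPerfectMatching M' → ∑ e ∈ M, w e ≤ ∑ e ∈ M', w e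

/-- Vertices that an alternating path joins to a vertex of the class `α` left exposed by the
matching `M`; here `E` and `M` are relations between the two vertex classes `α` and `β`, and the
path starts with an edge of `E` outside `M`. -/
inductive AltReachable {α β : Type*} (E M : α → β → Prop) : α ⊕ β → Prop
  | exposed (a : α) : (∀ b, ¬ M a b) → AltReachable E M (Sum.inl a)
  | unmatched (a : α) (b : β) : AltReachable E M (Sum.inl a) → E a b → ¬ M a b →
      AltReachable E M (Sum.inr b)
  | matched (a : α) (b : β) : AltReachable E M (Sum.inr b) → M a b →
      AltReachable E M (Sum.inl a)

/-- A matching `M` together with a set of vertices `V_c = (R_c, P_c)`. -/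
structure MatchingAndCover (R P : Type*) where
  /-- the matching `M` -/
  matching : Finset (R × P)
  /-- the covered robots `R_c` -/
  robots : Finset R
  /-- the covered targets `P_c` -/
  targets : Finset P

/-- `V_c` is the minimum vertex cover of `(V, E)` that König's construction yields from the maximum
matching `M`, starting from the exposed targets: the covered robots are those that an alternating
path from an exposed target reaches, the covered targets are those that none reaches. -/
def IsCoverFromTargets {R P : Type*} (E : Finset (R × P)) (c : MatchingAndCover R P) : Prop :=
  (∀ i : R, i ∈ c.robots ↔
    AltReachable (fun j i => (i, j) ∈ E) (fun j i => (i, j) ∈ c.matching) (Sum.inr i)) ∧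
  (∀ j : P, j ∈ c.targets ↔
    ¬ AltReachable (fun j i => (i, j) ∈ E) (fun j i => (i, j) ∈ c.matching) (Sum.inl j))

/-- The mirror image of `IsCoverFromTargets`: König's construction started from the exposed
robots. -/
def IsCoverFromRobots {R P : Type*} (E : Finset (R × P)) (c : MatchingAndCover R P) : Prop :=
  (∀ i : R, i ∈ c.robots ↔
    ¬ AltReachable (fun i j => (i, j) ∈ E) (fun i j => (i, j) ∈ c.matching) (Sum.inl i)) ∧
  (∀ j : P, j ∈ c.targets ↔
    AltReachable (fun i j => (i, j) ∈ E) (fun i j => (i, j) ∈ c.matching) (Sum.inr j))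

/-- `slack (w, y, i, j)` for the edge `e = (i, j)` and the vertex labels `y`. -/
def slack {R P : Type*} (w : R × P → ℝ) (y : R ⊕ P → ℝ) (e : R × P) : ℝ :=
  w e - (y (Sum.inl e.1) + y (Sum.inr e.2))

end Bipartite

/-! ### The assignment problem -/

section Problem

/-- The data `P^i`, `c^i : P^i → ℝ` of all robots, and the weight `𝔐` put on the edges that are
added to make the bipartite graph complete. -/
structure AssignmentProblem (R P : Type*) where
  /-- the targets `P^i` that robot `i` can be assigned to -/
  admissible : R → Finset P
  /-- the cost function `c^i` -/
  cost : (i : R) → {j : P // j ∈ admissible i} → ℝ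
  /-- the weight of the added edges -/
  bigM : ℝ

open Classical in
/-- The weight function of the completed graph; its restriction to the edges of robot `i` is the
weight function of the original information of robot `i`. -/
noncomputable def AssignmentProblem.weight {R P : Type*} (A : AssignmentProblem R P) :
    R × P → ℝ := fun e =>
  if h : e.2 ∈ A.admissible e.1 then A.cost e.1 ⟨e.2, h⟩ else A.bigM

open Classical in
/-- The edges `(i, j)`, `j ∈ P^i`, of the graph before it is completed. -/
noncomputable def AssignmentProblem.edges {R P : Type*} [Fintype R] [Fintype P]
    (A : AssignmentProblem R P) : Finset (R × P) :=
  Finset.univ.filter fun e => e.2 ∈ A.admissible e.1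

/-- `𝔐` is prohibitively large: a perfect matching that uses an added edge is more expensive than
every perfect matching that uses none. -/
def AssignmentProblem.BigMProhibitive {R P : Type*} [Fintype R] [Fintype P]
    (A : AssignmentProblem R P) : Prop :=
  ∀ M M' : Finset (R × P), IsPerfectMatching M → IsPerfectMatching M' →
    M ⊆ A.edges → ¬ M' ⊆ A.edges → ∑ e ∈ M, A.weight e < ∑ e ∈ M', A.weight e

end Problem

/-! ### The algorithm -/

section Algorithm

/-- The state of a robot: the graph `G_lean` (edge sets `E_y` and `E_cand` and the weights
`w_lean`, which matter on these edges only), the vertex labels `y` and the counter `γ`. -/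
structure State (R P : Type*) where
  /-- `E_y` -/
  eqEdges : Finset (R × P)
  /-- `E_cand` -/
  candEdges : Finset (R × P)
  /-- `w_lean` -/
  weight : R × P → ℝ
  /-- `y` -/
  label : R ⊕ P → ℝ
  /-- `γ` -/
  counter : ℤ

/-- The choices that the algorithm leaves open, as deterministic routines that all robots share:
the matching and cover subroutine, the pruning subroutine, and the rule by which a robot breaks
ties between its best edges. -/
structure Routines {R P : Type*} (A : AssignmentProblem R P) where
  /-- computes `(M, V_c)` from `E_y` -/
  solve : Finset (R × P) → MatchingAndCover R P
  /-- `M` is a maximum cardinality matching of `(V, E)` -/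
  solve_matching : ∀ E, IsMaximumMatching E (solve E).matching
  /-- `V_c` is the corresponding minimum vertex cover; the implementation fixes from which side
  it is constructed -/
  solve_cover : (∀ E, IsCoverFromTargets E (solve E)) ∨ (∀ E, IsCoverFromRobots E (solve E))
  /-- `Reduce_Edge_Set` -/
  reduce : Finset (R × P) → Finset (R × P)
  /-- pruning only removes edges -/
  reduce_subset : ∀ E, reduce E ⊆ E
  /-- pruning leaves `M` and `V_c` unchanged; removing as many edges as possible under this
  condition is one possibility, the theorem covers all others as well -/
  solve_reduce : ∀ E, solve (reduce E) = solve E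
  /-- robot `i`'s choice of `j⋆`, given the vertex labels `y` and the covered targets `P_c` -/
  pick : R → (R ⊕ P → ℝ) → Finset P → P
  /-- an uncovered target is chosen, if there is one -/
  pick_not_mem : ∀ i y Pc, (∃ j, j ∉ Pc) → pick i y Pc ∉ Pc
  /-- the chosen edge has minimum slack -/
  pick_min : ∀ i y Pc, ∀ j ∉ Pc, slack A.weight y (i, pick i y Pc) ≤ slack A.weight y (i, j)

/-- The assignment that a robot in state `g` holds: its matching `M` with respect to `(V, E_y)`. -/
def Routines.assignment {R P : Type*} {A : AssignmentProblem R P} (ρ : Routines A)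
    (g : State R P) : Finset (R × P) :=
  (ρ.solve g.eqEdges).matching

open Classical in
/-- `Get_Best_Edge` for robot `i`: a set with at most one edge, which is empty if robot `i` is
covered or there is no uncovered target. -/
noncomputable def bestEdge {R P : Type*} {A : AssignmentProblem R P} (ρ : Routines A) (i : R)
    (y : R ⊕ P → ℝ) (c : MatchingAndCover R P) : Finset (R × P) :=
  if i ∉ c.robots ∧ (∃ j, j ∉ c.targets) then {(i, ρ.pick i y c.targets)} else ∅

open Classical in
/-- The weights `w` of the lean graph after edges `new` of a robot's original information have been
added to it. -/
noncomputable def addWeights {R P : Type*} (A : AssignmentProblem R P)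
    (w : R × P → ℝ) (new : Finset (R × P)) : R × P → ℝ :=
  fun e => if e ∈ new then A.weight e else w e

/-- The minimum slack `δ` of the candidate edges (which are never empty where this is used). -/
noncomputable def minSlack {R P : Type*} (w : R × P → ℝ) (y : R ⊕ P → ℝ)
    (cand : Finset (R × P)) : ℝ :=
  if h : cand.Nonempty then cand.inf' h (slack w y) else 0

open Classical in
/-- `y (i) - δ` at covered robots `i`, `y (j) + δ` at uncovered targets `j`. -/
noncomputable def updateLabel {R P : Type*} (y : R ⊕ P → ℝ) (c : MatchingAndCover R P)
    (δ : ℝ) : R ⊕ P → ℝ :=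
  Sum.elim (fun i => if i ∈ c.robots then y (Sum.inl i) - δ else y (Sum.inl i))
    (fun j => if j ∈ c.targets then y (Sum.inr j) else y (Sum.inr j) + δ)

open Classical in
/-- The part of `Local_Hungarian` after the candidate edges are complete: labels, equality subgraph
(within the lean graph), matching and cover are updated, the counter is incremented, the candidate
edges are reset to robot `i`'s new best edge, and `E_y` is pruned. Here `g` is the state with the
completed candidate set and `c` the current `(M, V_c)`. -/
noncomputable def advance {R P : Type*} {A : AssignmentProblem R P} (ρ : Routines A) (i : R)
    (g : State R P) (c : MatchingAndCover R P) : State R P :=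
  let y := updateLabel g.label c (minSlack g.weight g.label g.candEdges)
  let Ey := (g.eqEdges ∪ g.candEdges).filter
    fun e => y (Sum.inl e.1) + y (Sum.inr e.2) = g.weight e
  let new := bestEdge ρ i y (ρ.solve Ey)
  { eqEdges := ρ.reduce Ey
    candEdges := new
    weight := addWeights A g.weight new
    label := y
    counter := g.counter + 1 }

open Classical in
/-- `Local_Hungarian`, run by robot `i` on the temporary state `g`. -/
noncomputable def localHungarian {R P : Type*} [Fintype R] {A : AssignmentProblem R P}
    (ρ : Routines A) (i : R) (g : State R P) : State R P :=
  let c := ρ.solve g.eqEdges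
  if IsPerfectMatching c.matching then g
  else
    let new := bestEdge ρ i g.label c
    let g' : State R P :=
      { eqEdges := g.eqEdges
        candEdges := g.candEdges ∪ new
        weight := addWeights A g.weight new
        label := g.label
        counter := g.counter }
    if (c.robotsᶜ).card = g'.candEdges.card then advance ρ i g' c else g'

/-- The weight of each edge of the lean graph `g` is the one recorded by a robot of `L` whose state
contains that edge. -/
def WeightsFrom {R P : Type*} (L : Finset R) (S : R → State R P) (g : State R P) : Prop :=
  ∀ e, (e ∈ g.eqEdges ∨ e ∈ g.candEdges) →
    ∃ j ∈ L, (e ∈ (S j).eqEdges ∨ e ∈ (S j).candEdges) ∧ g.weight e = (S j).weight e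

open Classical in
/-- The first case of `Build_Latest_Graph`: all counters are `-1`. Robots with an edge in the
merged set `E_y` are labelled with the weight of that edge. -/
def MergeInitial {R P : Type*} [Fintype R] (N : Finset R) (S : R → State R P)
    (g : State R P) : Prop :=
  g.eqEdges = N.biUnion (fun j => (S j).eqEdges) ∧
  g.candEdges = ∅ ∧
  WeightsFrom N S g ∧
  (∀ e ∈ g.eqEdges, g.label (Sum.inl e.1) = g.weight e) ∧
  (∀ i, (∀ e ∈ g.eqEdges, e.1 ≠ i) → g.label (Sum.inl i) = 0) ∧
  (∀ j, g.label (Sum.inr j) = 0) ∧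
  g.counter = if g.eqEdges.card = Fintype.card R then 0 else -1

open Classical in
/-- The robots of `N` with the highest counter, `R_lead`. -/
noncomputable def leaders {R P : Type*} (N : Finset R) (S : R → State R P) : Finset R :=
  N.filter fun j => ∀ k ∈ N, (S k).counter ≤ (S j).counter

open Classical in
/-- The second case of `Build_Latest_Graph`: counter, labels and `E_y` of any one leader are taken
over, and the candidate edges of all leaders are merged. -/
def MergeLeaders {R P : Type*} (N : Finset R) (S : R → State R P) (g : State R P) : Prop :=
  (∃ j ∈ leaders N S,
    g.counter = (S j).counter ∧ g.label = (S j).label ∧ g.eqEdges = (S j).eqEdges) ∧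
  g.candEdges = (leaders N S).biUnion (fun j => (S j).candEdges) ∧
  WeightsFrom (leaders N S) S g

/-- `g` is a possible result of `Build_Latest_Graph (N, S)`. -/
def BuildLatestGraph {R P : Type*} [Fintype R] (N : Finset R) (S : R → State R P)
    (g : State R P) : Prop :=
  ((∀ j ∈ N, (S j).counter = -1) ∧ MergeInitial N S g) ∨
  ((¬ ∀ j ∈ N, (S j).counter = -1) ∧ MergeLeaders N S g)

/-- `g` is a possible initial state of robot `i`: a minimum weight edge `(i, j⋆)` of its original
information, with the corresponding label, and counter `-1`. -/
def IsInitialState {R P : Type*} (A : AssignmentProblem R P) (i : R) (g : State R P) : Prop :=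
  ∃ jstar : P, (∀ j, A.weight (i, jstar) ≤ A.weight (i, j)) ∧
    g.eqEdges = {(i, jstar)} ∧
    g.candEdges = ∅ ∧
    g.weight (i, jstar) = A.weight (i, jstar) ∧
    g.label (Sum.inl i) = A.weight (i, jstar) ∧
    (∀ k, k ≠ i → g.label (Sum.inl k) = 0) ∧
    (∀ j, g.label (Sum.inr j) = 0) ∧
    g.counter = -1

open Classical in
/-- Robot `i` and its incoming neighbors in the communication digraph `D`. -/
noncomputable def inNeighborhood {R : Type*} [Fintype R] (D : Digraph R) (i : R) : Finset R :=
  Finset.univ.filter fun j => j = i ∨ D.Adj j i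

/-- There is a directed path from every vertex to every other vertex. -/
def StronglyConnected {R : Type*} (D : Digraph R) : Prop :=
  ∀ i j : R, Relation.ReflTransGen D.Adj i j

/-- `s k i` is the state of robot `i` at the time instant `τ k`, in a synchronous run of the
algorithm over the communication digraphs `G t`: at `τ k` every robot receives the states of its
incoming neighbors, builds a temporary state `g` from these and its own, and computes its new state
from `g` and its own original information. -/
structure IsExecution {R P : Type*} [Fintype R] {A : AssignmentProblem R P} (ρ : Routines A)
    (G : ℝ≥0 → Digraph R) (τ : ℕ → ℝ≥0) (s : ℕ → R → State R P) : Prop where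
  /-- initialization -/
  init : ∀ i, IsInitialState A i (s 0 i)
  /-- evolution -/
  step : ∀ k i, ∃ g : State R P, BuildLatestGraph (inNeighborhood (G (τ k)) i) (s k) g ∧
    (0 ≤ g.counter → s (k + 1) i = localHungarian ρ i g) ∧
    (g.counter < 0 → s (k + 1) i = g)

end Algorithm

end DistributedHungarian

set_option linter.unusedSectionVars false

/-! All robots run one and the same centralized Hungarian method. The edges `(i, j₀ i)` picked at
the start and the shared deterministic routines determine a sequence `stage ρ j₀ n` of pairs
(equality edges, labels). The invariant `IsConsistent` says that a robot with counter `n ≥ 0` holds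
exactly the `n`-th pair, and that its candidates lie in `allBestEdges` of it. That set has one edge
for each uncovered robot, so the cardinality test succeeds exactly when the candidates are complete,
and every robot that passes it makes the same Hungarian step (`IsConsistent.advance_eq`).

The method stops because of a lexicographic measure (`exists_progress_measure`): the size of the
matching, then the size of the side of the cover that alternating paths reach. A step may replace
the matching by an unrelated one of the same size, so the covers are not compared path by path.
Instead, König's cover is extremal among all covers as small as the matching (the `subset_of_tight`
lemmas), whichever maximum matching it is built from.

Counters never decrease along arcs and are bounded, so by strong connectivity they become constant
and equal (`exists_forall_ge_eq`). The same principle, applied to edge sets ordered by inclusion,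
shows that the common value is neither `-1` nor the index of a stage without a perfect matching:
otherwise the initial edges, or the candidates, would spread to all robots and force a counter up.
The final stage thus has a perfect matching of tight edges under feasible labels, which is optimal
by complementary slackness. -/

namespace DistributedHungarian

/-! ### König's theorem, extremality of König's covers, and linear programming duality -/

section Bipartite

variable {R P : Type*}

/-- Every edge of `E` has an end in `A` or in `B`. -/
def IsVertexCover (E : Finset (R × P)) (A : Finset R) (B : Finset P) : Prop :=
  ∀ e ∈ E, e.1 ∈ A ∨ e.2 ∈ B

theorem IsMatching.injOn_fst {M : Finset (R × P)} (hM : IsMatching M) :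
    Set.InjOn Prod.fst (M : Set (R × P)) :=
  fun e he f hf h => hM e he f hf (Or.inl h)

theorem IsMatching.injOn_snd {M : Finset (R × P)} (hM : IsMatching M) :
    Set.InjOn Prod.snd (M : Set (R × P)) :=
  fun e he f hf h => hM e he f hf (Or.inr h)

open Classical in
/-- The covered end of an edge, the first one if both are covered. -/
noncomputable def coveredEnd (A : Finset R) (e : R × P) : R ⊕ P :=
  if e.1 ∈ A then Sum.inl e.1 else Sum.inr e.2

theorem coveredEnd_mapsTo {E M : Finset (R × P)} {A : Finset R} {B : Finset P}
    (hME : M ⊆ E) (hE : IsVertexCover E A B) :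
    Set.MapsTo (coveredEnd A) (M : Set (R × P)) (A.disjSum B : Set (R ⊕ P)) := by
  intro e he
  unfold coveredEnd
  split_ifs with h
  · simpa using h
  · simpa using (hE e (hME he)).resolve_left h

/-- Edges of a matching share no vertex, so no vertex is the covered end of two of them. When the
cover is no larger than the matching, this injection is a bijection, which yields the structure of
tight covers used below. -/
theorem IsMatching.injOn_coveredEnd {M : Finset (R × P)} (hM : IsMatching M) (A : Finset R) :
    Set.InjOn (coveredEnd A) (M : Set (R × P)) := by
  intro e he f hf h
  unfold coveredEnd at h
  split_ifs at h with h1 h2 h2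
  · exact hM e he f hf (Or.inl (Sum.inl_injective h))
  · exact hM e he f hf (Or.inr (Sum.inr_injective h))

/-- The vertices of a cover that is no larger than a matching are ends of distinct edges of the
matching. -/
theorem IsMatching.exists_coveredEnd_eq {E M : Finset (R × P)} {A : Finset R} {B : Finset P}
    (hM : IsMatching M) (hME : M ⊆ E) (hE : IsVertexCover E A B)
    (hcard : A.card + B.card ≤ M.card) {v : R ⊕ P} (hv : v ∈ A.disjSum B) :
    ∃ e ∈ M, coveredEnd A e = v := by
  have := Finset.surj_on_of_inj_on_of_card_le (s := M) (t := A.disjSum B)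
    (fun e _ => coveredEnd A e) (fun e he => coveredEnd_mapsTo hME hE he)
    (fun e f he hf h => hM.injOn_coveredEnd A he hf h) (by rwa [Finset.card_disjSum]) v hv
  obtain ⟨e, he, h⟩ := this
  exact ⟨e, he, h.symm⟩

theorem IsMatching.exists_mem_of_mem_robots {E M : Finset (R × P)} {A : Finset R} {B : Finset P}
    (hM : IsMatching M) (hME : M ⊆ E) (hE : IsVertexCover E A B)
    (hcard : A.card + B.card ≤ M.card) {i : R} (hi : i ∈ A) : ∃ j, (i, j) ∈ M := by
  obtain ⟨e, he, h⟩ := hM.exists_coveredEnd_eq hME hE hcard (v := Sum.inl i) (by simpa using hi)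
  unfold coveredEnd at h
  split_ifs at h
  cases Sum.inl_injective h
  exact ⟨e.2, he⟩

/-- The partner lies outside `A` because `coveredEnd` takes a target only if the robot is not
covered. -/
theorem IsMatching.exists_mem_of_mem_targets {E M : Finset (R × P)} {A : Finset R}
    {B : Finset P} (hM : IsMatching M) (hME : M ⊆ E) (hE : IsVertexCover E A B)
    (hcard : A.card + B.card ≤ M.card) {j : P} (hj : j ∈ B) : ∃ i, i ∉ A ∧ (i, j) ∈ M := by
  obtain ⟨e, he, h⟩ := hM.exists_coveredEnd_eq hME hE hcard (v := Sum.inr j) (by simpa using hj)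
  unfold coveredEnd at h
  split_ifs at h with h1
  cases Sum.inr_injective h
  exact ⟨e.1, h1, he⟩

theorem IsMatching.notMem_targets {E M : Finset (R × P)} {A : Finset R} {B : Finset P}
    (hM : IsMatching M) (hME : M ⊆ E) (hE : IsVertexCover E A B)
    (hcard : A.card + B.card ≤ M.card) {e : R × P} (he : e ∈ M) (hi : e.1 ∈ A) : e.2 ∉ B := by
  intro hj
  obtain ⟨i, hiA, hiM⟩ := hM.exists_mem_of_mem_targets hME hE hcard hj
  have := hM e he _ hiM (Or.inr rfl)
  rw [this] at hi
  exact hiA hi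

/-- Distinct ends of distinct edges of `M` are at most as many as the edges of `M`. -/
theorem card_add_card_le_of_forall_mem {M : Finset (R × P)} {A : Finset R} {B : Finset P}
    (hA : ∀ i ∈ A, ∃ j, (i, j) ∈ M) (hB : ∀ j ∈ B, ∃ i, (i, j) ∈ M)
    (hAB : ∀ e ∈ M, e.1 ∈ A → e.2 ∉ B) : A.card + B.card ≤ M.card := by
  classical
  have h1 : A ⊆ (M.filter fun e => e.1 ∈ A).image Prod.fst := by
    intro i hi
    obtain ⟨j, hj⟩ := hA i hi
    exact Finset.mem_image.2 ⟨(i, j), Finset.mem_filter.2 ⟨hj, hi⟩, rfl⟩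
  have h2 : B ⊆ (M.filter fun e => e.2 ∈ B).image Prod.snd := by
    intro j hj
    obtain ⟨i, hi⟩ := hB j hj
    exact Finset.mem_image.2 ⟨(i, j), Finset.mem_filter.2 ⟨hi, hj⟩, rfl⟩
  have h3 : Disjoint (M.filter fun e => e.1 ∈ A) (M.filter fun e => e.2 ∈ B) := by
    rw [Finset.disjoint_filter]
    exact hAB
  calc A.card + B.card ≤ (M.filter fun e => e.1 ∈ A).card + (M.filter fun e => e.2 ∈ B).card :=
        add_le_add ((Finset.card_le_card h1).trans Finset.card_image_le)
          ((Finset.card_le_card h2).trans Finset.card_image_le)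
    _ = ((M.filter fun e => e.1 ∈ A) ∪ (M.filter fun e => e.2 ∈ B)).card :=
        (Finset.card_union_of_disjoint h3).symm
    _ ≤ M.card := Finset.card_le_card
        (Finset.union_subset (Finset.filter_subset _ _) (Finset.filter_subset _ _))

/-- **König's theorem**, the existence of a matching as large as some vertex cover. -/
theorem exists_isMatching_card_eq_cover [Fintype R] [Fintype P] (E : Finset (R × P)) :
    ∃ (N : Finset (R × P)) (A : Finset R) (B : Finset P),
      N ⊆ E ∧ IsMatching N ∧ IsVertexCover E A B ∧ A.card + B.card ≤ N.card := by
  classical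
  obtain ⟨⟨A, B⟩, hAB, hmin⟩ := Finset.exists_min_image
    ((Finset.univ : Finset (Finset R × Finset P)).filter fun c => IsVertexCover E c.1 c.2)
    (fun c => c.1.card + c.2.card)
    ⟨(Finset.univ, ∅), by simp [IsVertexCover]⟩
  simp only [Finset.mem_filter, Finset.mem_univ, true_and, Prod.forall] at hAB hmin
  -- Hall's condition for the edges between `A` and the complement of `B`, and vice versa
  have hallA : ∃ f : A → P, Function.Injective f ∧
      ∀ i : A, f i ∈ Finset.univ.filter fun j => j ∉ B ∧ ((i : R), j) ∈ E := by
    rw [← Finset.all_card_le_biUnion_card_iff_exists_injective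
      (fun i : A => Finset.univ.filter fun j => j ∉ B ∧ ((i : R), j) ∈ E)]
    intro X
    set Y := X.biUnion (fun i : A => Finset.univ.filter fun j => j ∉ B ∧ ((i : R), j) ∈ E) with hY
    set X' := X.map (Function.Embedding.subtype _) with hX'
    have hX'A : X' ⊆ A := by
      intro i hi
      rw [hX', Finset.mem_map] at hi
      obtain ⟨a, _, rfl⟩ := hi
      exact a.2
    -- Exchange `X` for its neighbors outside `B`: the result still covers, so minimality of `(A,
    -- B)` forces `|X| ≤ |Y|`.
    have hcov : IsVertexCover E (A \ X') (B ∪ Y) := by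
      rintro ⟨i, j⟩ he
      by_cases hj : j ∈ B
      · exact Or.inr (Finset.mem_union_left _ hj)
      have hi : i ∈ A := (hAB _ he).resolve_right hj
      by_cases hiX : i ∈ X'
      · obtain ⟨a, ha, rfl⟩ := Finset.mem_map.1 hiX
        refine Or.inr (Finset.mem_union_right _ (Finset.mem_biUnion.2 ⟨a, ha, ?_⟩))
        simpa using ⟨hj, he⟩
      · exact Or.inl (Finset.mem_sdiff.2 ⟨hi, hiX⟩)
    have h1 := hmin _ _ hcov
    have h2 := Finset.card_sdiff_add_card_eq_card hX'A
    have h3 := Finset.card_union_le B Y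
    have h4 : X'.card = X.card := Finset.card_map _
    omega
  have hallB : ∃ f : B → R, Function.Injective f ∧
      ∀ j : B, f j ∈ Finset.univ.filter fun i => i ∉ A ∧ (i, (j : P)) ∈ E := by
    rw [← Finset.all_card_le_biUnion_card_iff_exists_injective
      (fun j : B => Finset.univ.filter fun i => i ∉ A ∧ (i, (j : P)) ∈ E)]
    intro X
    set Y := X.biUnion (fun j : B => Finset.univ.filter fun i => i ∉ A ∧ (i, (j : P)) ∈ E) with hY
    set X' := X.map (Function.Embedding.subtype _) with hX'
    have hX'B : X' ⊆ B := by
      intro i hi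
      rw [hX', Finset.mem_map] at hi
      obtain ⟨a, _, rfl⟩ := hi
      exact a.2
    have hcov : IsVertexCover E (A ∪ Y) (B \ X') := by
      rintro ⟨i, j⟩ he
      by_cases hi : i ∈ A
      · exact Or.inl (Finset.mem_union_left _ hi)
      have hj : j ∈ B := (hAB _ he).resolve_left hi
      by_cases hjX : j ∈ X'
      · obtain ⟨a, ha, rfl⟩ := Finset.mem_map.1 hjX
        refine Or.inl (Finset.mem_union_right _ (Finset.mem_biUnion.2 ⟨a, ha, ?_⟩))
        simpa using ⟨hi, he⟩
      · exact Or.inr (Finset.mem_sdiff.2 ⟨hj, hjX⟩)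
    have h1 := hmin _ _ hcov
    have h2 := Finset.card_sdiff_add_card_eq_card hX'B
    have h3 := Finset.card_union_le A Y
    have h4 : X'.card = X.card := Finset.card_map _
    omega
  obtain ⟨f, hf, hfE⟩ := hallA
  obtain ⟨g, hg, hgE⟩ := hallB
  simp only [Finset.mem_filter, Finset.mem_univ, true_and] at hfE hgE
  -- The two families do not meet: `f` avoids `B` and `g` avoids `A`.
  refine ⟨Finset.univ.image (fun i : A => ((i : R), f i)) ∪
    Finset.univ.image (fun j : B => (g j, (j : P))), A, B, ?_, ?_, hAB, ?_⟩
  · intro e he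
    simp only [Finset.mem_union, Finset.mem_image, Finset.mem_univ, true_and] at he
    rcases he with ⟨i, rfl⟩ | ⟨j, rfl⟩
    · exact (hfE i).2
    · exact (hgE j).2
  · intro e he e' he' h
    simp only [Finset.mem_union, Finset.mem_image, Finset.mem_univ, true_and] at he he'
    rcases he with ⟨i, rfl⟩ | ⟨j, rfl⟩ <;> rcases he' with ⟨i', rfl⟩ | ⟨j', rfl⟩ <;>
      dsimp only at h
    · rcases h with h | h
      · rw [Subtype.ext h]
      · rw [hf h]
    · rcases h with h | h
      · exact absurd (h ▸ i.2) (hgE j').1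
      · exact absurd (h ▸ j'.2) (hfE i).1
    · rcases h with h | h
      · exact absurd (h ▸ i'.2) (hgE j).1
      · exact absurd (h ▸ j.2) (hfE i').1
    · rcases h with h | h
      · rw [hg h]
      · rw [Subtype.ext h]
  · apply card_add_card_le_of_forall_mem
    · intro i hi
      exact ⟨f ⟨i, hi⟩, Finset.mem_union_left _ (Finset.mem_image.2 ⟨⟨i, hi⟩, by simp⟩)⟩
    · intro j hj
      exact ⟨g ⟨j, hj⟩, Finset.mem_union_right _ (Finset.mem_image.2 ⟨⟨j, hj⟩, by simp⟩)⟩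
    · intro e he hi
      simp only [Finset.mem_union, Finset.mem_image, Finset.mem_univ, true_and] at he
      rcases he with ⟨i, rfl⟩ | ⟨j, rfl⟩
      · exact (hfE i).1
      · exact absurd hi (hgE j).1

theorem IsMaximumMatching.exists_tight_cover [Fintype R] [Fintype P] {E M : Finset (R × P)}
    (hM : IsMaximumMatching E M) :
    ∃ (A : Finset R) (B : Finset P), IsVertexCover E A B ∧ A.card + B.card ≤ M.card := by
  obtain ⟨N, A, B, hNE, hN, hAB, hcard⟩ := exists_isMatching_card_eq_cover E
  exact ⟨A, B, hAB, hcard.trans (hM.2.2 N hNE hN)⟩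

/-- Among all covers of minimum size, König's construction from the exposed targets yields the one
with the fewest robots. The cover may be one of another graph `E'` that shares with `E` the edges
that are not covered twice. -/
theorem IsCoverFromTargets.subset_of_tight {E E' : Finset (R × P)} {c : MatchingAndCover R P}
    (hc : IsCoverFromTargets E c) (hM : IsMatching c.matching) (hME' : c.matching ⊆ E')
    (hEE' : ∀ e ∈ E, ¬ (e.1 ∈ c.robots ∧ e.2 ∈ c.targets) → e ∈ E')
    {A : Finset R} {B : Finset P} (hAB : IsVertexCover E' A B)
    (hcard : A.card + B.card ≤ c.matching.card) : c.robots ⊆ A ∧ B ⊆ c.targets := by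
  -- Follow an alternating path. Targets in `B` are matched, so it starts outside `B`; an edge
  -- leaving a target outside `B` must be covered in `A`; a matching edge with its robot in `A` has
  -- its target outside `B`, the cover being tight. Reached targets are not in `c.targets`, so the
  -- non-matching edges of the path survive in `E'`.
  have key : ∀ v, AltReachable (fun j i => (i, j) ∈ E) (fun j i => (i, j) ∈ c.matching) v →
      Sum.elim (fun j => j ∉ B) (fun i => i ∈ A) v := by
    intro v hv
    induction hv with
    | exposed j hj =>
      intro hjB
      obtain ⟨i, -, hi⟩ := hM.exists_mem_of_mem_targets hME' hAB hcard hjB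
      exact hj i hi
    | unmatched j i hj hij hijM ih =>
      have : (i, j) ∈ E' := hEE' _ hij fun h => (hc.2 j).1 h.2 hj
      exact (hAB _ this).resolve_right ih
    | matched j i hi hij ih => exact hM.notMem_targets hME' hAB hcard hij ih
  refine ⟨fun i hi => key _ ((hc.1 i).1 hi), fun j hj => (hc.2 j).2 fun h => key _ h hj⟩

theorem IsCoverFromRobots.subset_of_tight {E E' : Finset (R × P)} {c : MatchingAndCover R P}
    (hc : IsCoverFromRobots E c) (hM : IsMatching c.matching) (hME' : c.matching ⊆ E')
    (hEE' : ∀ e ∈ E, ¬ (e.1 ∈ c.robots ∧ e.2 ∈ c.targets) → e ∈ E')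
    {A : Finset R} {B : Finset P} (hAB : IsVertexCover E' A B)
    (hcard : A.card + B.card ≤ c.matching.card) : A ⊆ c.robots ∧ c.targets ⊆ B := by
  have key : ∀ v, AltReachable (fun i j => (i, j) ∈ E) (fun i j => (i, j) ∈ c.matching) v →
      Sum.elim (fun i => i ∉ A) (fun j => j ∈ B) v := by
    intro v hv
    induction hv with
    | exposed i hi =>
      intro hiA
      obtain ⟨j, hj⟩ := hM.exists_mem_of_mem_robots hME' hAB hcard hiA
      exact hi j hj
    | unmatched i j hi hij hijM ih =>
      have : (i, j) ∈ E' := hEE' _ hij fun h => (hc.1 i).1 h.1 hi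
      exact (hAB _ this).resolve_left ih
    | matched i j hj hij ih =>
      exact fun hiA => hM.notMem_targets hME' hAB hcard hij hiA ih
  refine ⟨fun i hi => (hc.1 i).2 fun h => key _ h hi, fun j hj => key _ ((hc.2 j).1 hj)⟩

/-- If the target is reached, a non-matching edge prolongs the path to its robot, while a matching
edge is the only way the target can have been reached, hence through that robot. -/
theorem IsCoverFromTargets.isVertexCover {E : Finset (R × P)} {c : MatchingAndCover R P}
    (hc : IsCoverFromTargets E c) (hM : IsMatching c.matching) :
    IsVertexCover E c.robots c.targets := by
  rintro ⟨i, j⟩ he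
  rw [or_iff_not_imp_right]
  intro hj
  rw [hc.2, not_not] at hj
  by_cases hij : (i, j) ∈ c.matching
  · cases hj with
    | exposed _ h => exact absurd hij (h i)
    | matched _ i' hi' h =>
      cases hM _ hij _ h (Or.inr rfl)
      exact (hc.1 i).2 hi'
  · exact (hc.1 i).2 (AltReachable.unmatched j i hj he hij)

theorem IsCoverFromRobots.isVertexCover {E : Finset (R × P)} {c : MatchingAndCover R P}
    (hc : IsCoverFromRobots E c) (hM : IsMatching c.matching) :
    IsVertexCover E c.robots c.targets := by
  rintro ⟨i, j⟩ he
  rw [or_iff_not_imp_left]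
  intro hi
  rw [hc.1, not_not] at hi
  by_cases hij : (i, j) ∈ c.matching
  · cases hi with
    | exposed _ h => exact absurd hij (h j)
    | matched _ j' hj' h =>
      cases hM _ hij _ h (Or.inl rfl)
      exact (hc.2 j).2 hj'
  · exact (hc.2 j).2 (AltReachable.unmatched i j hi he hij)

/-- Comparison with some tight cover shows that reached robots are matched, so no augmenting path
argument is needed. Unreached targets are not exposed, and a matching edge from a reached robot
leads to a reached target. -/
theorem IsCoverFromTargets.card_le [Fintype R] [Fintype P] {E : Finset (R × P)}
    {c : MatchingAndCover R P} (hc : IsCoverFromTargets E c)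
    (hM : IsMaximumMatching E c.matching) :
    c.robots.card + c.targets.card ≤ c.matching.card := by
  obtain ⟨A, B, hAB, hcard⟩ := hM.exists_tight_cover
  obtain ⟨h1, -⟩ := hc.subset_of_tight hM.2.1 hM.1 (fun e he _ => he) hAB hcard
  apply card_add_card_le_of_forall_mem
  · exact fun i hi => hM.2.1.exists_mem_of_mem_robots hM.1 hAB hcard (h1 hi)
  · intro j hj
    by_contra! h
    exact (hc.2 j).1 hj (AltReachable.exposed j h)
  · intro e he hi hj
    exact (hc.2 _).1 hj (AltReachable.matched e.2 e.1 ((hc.1 _).1 hi) he)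

theorem IsCoverFromRobots.card_le [Fintype R] [Fintype P] {E : Finset (R × P)}
    {c : MatchingAndCover R P} (hc : IsCoverFromRobots E c)
    (hM : IsMaximumMatching E c.matching) :
    c.robots.card + c.targets.card ≤ c.matching.card := by
  obtain ⟨A, B, hAB, hcard⟩ := hM.exists_tight_cover
  obtain ⟨-, h1⟩ := hc.subset_of_tight hM.2.1 hM.1 (fun e he _ => he) hAB hcard
  apply card_add_card_le_of_forall_mem
  · intro i hi
    by_contra! h
    exact (hc.1 i).1 hi (AltReachable.exposed i h)
  · intro j hj
    obtain ⟨i, -, hi⟩ := hM.2.1.exists_mem_of_mem_targets hM.1 hAB hcard (h1 hj)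
    exact ⟨i, hi⟩
  · intro e he hi hj
    exact (hc.1 _).1 hi (AltReachable.matched e.1 e.2 ((hc.2 _).1 hj) he)

theorem IsMatching.card_le_robots [Fintype R] {M : Finset (R × P)} (hM : IsMatching M) :
    M.card ≤ Fintype.card R := by
  classical
  rw [← Finset.card_image_of_injOn hM.injOn_fst]
  exact Finset.card_le_univ _

theorem IsMatching.card_lt_of_not_perfect [Fintype R] [Fintype P]
    (hcard : Fintype.card R = Fintype.card P) {M : Finset (R × P)} (hM : IsMatching M)
    (hp : ¬ IsPerfectMatching M) : M.card < Fintype.card R := by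
  classical
  refine lt_of_le_of_ne hM.card_le_robots fun h => hp ⟨hM, ?_, ?_⟩
  · have h1 : M.image Prod.fst = Finset.univ :=
      Finset.eq_univ_of_card _ (by rw [Finset.card_image_of_injOn hM.injOn_fst, h])
    intro i
    obtain ⟨e, he, rfl⟩ := Finset.mem_image.1 (h1 ▸ Finset.mem_univ i)
    exact ⟨e.2, he⟩
  · have h1 : M.image Prod.snd = Finset.univ :=
      Finset.eq_univ_of_card _ (by rw [Finset.card_image_of_injOn hM.injOn_snd, h, hcard])
    intro j
    obtain ⟨e, he, rfl⟩ := Finset.mem_image.1 (h1 ▸ Finset.mem_univ j)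
    exact ⟨e.1, he⟩

theorem IsPerfectMatching.sum_label [Fintype R] [Fintype P] {M : Finset (R × P)}
    (hM : IsPerfectMatching M) (y : R ⊕ P → ℝ) :
    ∑ e ∈ M, (y (Sum.inl e.1) + y (Sum.inr e.2)) = ∑ i, y (Sum.inl i) + ∑ j, y (Sum.inr j) := by
  classical
  obtain ⟨hM, hR, hP⟩ := hM
  have h1 : M.image Prod.fst = Finset.univ := by
    refine Finset.eq_univ_iff_forall.2 fun i => ?_
    obtain ⟨j, hj⟩ := hR i
    exact Finset.mem_image_of_mem Prod.fst hj
  have h2 : M.image Prod.snd = Finset.univ := by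
    refine Finset.eq_univ_iff_forall.2 fun j => ?_
    obtain ⟨i, hi⟩ := hP j
    exact Finset.mem_image_of_mem Prod.snd hi
  rw [Finset.sum_add_distrib, ← h1, ← h2, Finset.sum_image hM.injOn_fst,
    Finset.sum_image hM.injOn_snd]

/-- Complementary slackness: a perfect matching of tight edges is optimal if the labels are
feasible. -/
theorem IsPerfectMatching.isMinWeight [Fintype R] [Fintype P] {M : Finset (R × P)}
    (hM : IsPerfectMatching M) {w : R × P → ℝ} {y : R ⊕ P → ℝ} (hy : ∀ e, 0 ≤ slack w y e)
    (ht : ∀ e ∈ M, slack w y e = 0) : IsMinWeightPerfectMatching Finset.univ w M := by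
  refine ⟨Finset.subset_univ _, hM, fun M' _ hM' => ?_⟩
  calc ∑ e ∈ M, w e = ∑ e ∈ M, (y (Sum.inl e.1) + y (Sum.inr e.2)) :=
        Finset.sum_congr rfl fun e he => sub_eq_zero.1 (ht e he)
    _ = ∑ e ∈ M', (y (Sum.inl e.1) + y (Sum.inr e.2)) := by rw [hM.sum_label, hM'.sum_label]
    _ ≤ ∑ e ∈ M', w e := Finset.sum_le_sum fun e _ => sub_nonneg.1 (hy e)

end Bipartite

/-! ### Growth of the matching or of the reached side of the cover -/

section Progress

variable {R P : Type*} [Fintype R] [Fintype P]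

/-- Adding an edge between two uncovered vertices enlarges the matching or the set of reached
robots. -/
theorem IsCoverFromTargets.progress {E E' : Finset (R × P)} {c c' : MatchingAndCover R P}
    (hc : IsCoverFromTargets E c) (hc' : IsCoverFromTargets E' c')
    (hM : IsMaximumMatching E c.matching) (hM' : IsMaximumMatching E' c'.matching)
    (hME' : c.matching ⊆ E')
    (hEE' : ∀ e ∈ E, ¬ (e.1 ∈ c.robots ∧ e.2 ∈ c.targets) → e ∈ E')
    {e : R × P} (he : e ∈ E') (h1 : e.1 ∉ c.robots) (h2 : e.2 ∉ c.targets) :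
    c.matching.card < c'.matching.card ∨
      c.matching.card = c'.matching.card ∧ c.robots.card < c'.robots.card := by
  rcases (hM'.2.2 _ hME' hM.2.1).lt_or_eq with h | h
  · exact Or.inl h
  refine Or.inr ⟨h, Finset.card_lt_card ?_⟩
  have hcov := hc'.isVertexCover hM'.2.1
  -- At equal matching size the new cover is tight for the old matching too. Its targets are among
  -- the old ones, so the new edge can only be covered by its robot, which was not covered before.
  obtain ⟨h3, h4⟩ := hc.subset_of_tight hM.2.1 hME' hEE' hcov (by rw [h]; exact hc'.card_le hM')
  exact Finset.ssubset_iff_subset_ne.2 ⟨h3, fun h5 =>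
    h1 (h5 ▸ (hcov e he).resolve_right fun h6 => h2 (h4 h6))⟩

theorem IsCoverFromRobots.progress {E E' : Finset (R × P)} {c c' : MatchingAndCover R P}
    (hc : IsCoverFromRobots E c) (hc' : IsCoverFromRobots E' c')
    (hM : IsMaximumMatching E c.matching) (hM' : IsMaximumMatching E' c'.matching)
    (hME' : c.matching ⊆ E')
    (hEE' : ∀ e ∈ E, ¬ (e.1 ∈ c.robots ∧ e.2 ∈ c.targets) → e ∈ E')
    {e : R × P} (he : e ∈ E') (h1 : e.1 ∉ c.robots) (h2 : e.2 ∉ c.targets) :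
    c.matching.card < c'.matching.card ∨
      c.matching.card = c'.matching.card ∧ c.targets.card < c'.targets.card := by
  rcases (hM'.2.2 _ hME' hM.2.1).lt_or_eq with h | h
  · exact Or.inl h
  refine Or.inr ⟨h, Finset.card_lt_card ?_⟩
  have hcov := hc'.isVertexCover hM'.2.1
  obtain ⟨h3, h4⟩ := hc.subset_of_tight hM.2.1 hME' hEE' hcov (by rw [h]; exact hc'.card_le hM')
  exact Finset.ssubset_iff_subset_ne.2 ⟨h4, fun h5 =>
    h2 (h5 ▸ (hcov e he).resolve_left fun h6 => h1 (h3 h6))⟩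

end Progress

/-! ### The centralized Hungarian method and its termination -/

section Stages

variable {R P : Type*} [Fintype R] [Fintype P] {A : AssignmentProblem R P} (ρ : Routines A)

theorem Routines.isMatching (E : Finset (R × P)) : IsMatching (ρ.solve E).matching :=
  (ρ.solve_matching E).2.1

theorem Routines.matching_subset (E : Finset (R × P)) : (ρ.solve E).matching ⊆ E :=
  (ρ.solve_matching E).1

theorem Routines.isVertexCover (E : Finset (R × P)) :
    IsVertexCover E (ρ.solve E).robots (ρ.solve E).targets :=
  ρ.solve_cover.elim (fun h => (h E).isVertexCover (ρ.isMatching E))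
    fun h => (h E).isVertexCover (ρ.isMatching E)

theorem Routines.card_cover_le (E : Finset (R × P)) :
    (ρ.solve E).robots.card + (ρ.solve E).targets.card ≤ (ρ.solve E).matching.card :=
  ρ.solve_cover.elim (fun h => (h E).card_le (ρ.solve_matching E))
    fun h => (h E).card_le (ρ.solve_matching E)

/-- A tight cover contains exactly one end of each matching edge; this keeps matching edges tight
when the labels change. -/
theorem Routines.robots_iff_notMem_targets {E : Finset (R × P)} {e : R × P}
    (he : e ∈ (ρ.solve E).matching) : e.1 ∈ (ρ.solve E).robots ↔ e.2 ∉ (ρ.solve E).targets :=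
  ⟨(ρ.isMatching E).notMem_targets (ρ.matching_subset E) (ρ.isVertexCover E)
    (ρ.card_cover_le E) he, (ρ.isVertexCover E e (ρ.matching_subset E he)).resolve_right⟩

theorem Routines.exists_notMem_robots (hcard : Fintype.card R = Fintype.card P)
    {E : Finset (R × P)} (hp : ¬ IsPerfectMatching (ρ.solve E).matching) :
    ∃ i, i ∉ (ρ.solve E).robots := by
  by_contra! h
  have h1 : (ρ.solve E).robots.card = Fintype.card R := by
    rw [Finset.eq_univ_iff_forall.2 h, Finset.card_univ]
  have h2 := (ρ.isMatching E).card_lt_of_not_perfect hcard hp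
  have h3 := ρ.card_cover_le E
  omega

theorem Routines.exists_notMem_targets (hcard : Fintype.card R = Fintype.card P)
    {E : Finset (R × P)} (hp : ¬ IsPerfectMatching (ρ.solve E).matching) :
    ∃ j, j ∉ (ρ.solve E).targets := by
  by_contra! h
  have h1 : (ρ.solve E).targets.card = Fintype.card P := by
    rw [Finset.eq_univ_iff_forall.2 h, Finset.card_univ]
  have h2 := (ρ.isMatching E).card_lt_of_not_perfect hcard hp
  have h3 := ρ.card_cover_le E
  omega

open Classical in
/-- The best edges of all robots, for a pair of equality edges and labels. -/
noncomputable def allBestEdges (x : Finset (R × P) × (R ⊕ P → ℝ)) : Finset (R × P) :=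
  Finset.univ.biUnion fun i => bestEdge ρ i x.2 (ρ.solve x.1)

theorem mem_bestEdge {i : R} {y : R ⊕ P → ℝ} {c : MatchingAndCover R P} {e : R × P} :
    e ∈ bestEdge ρ i y c ↔
      i ∉ c.robots ∧ (∃ j, j ∉ c.targets) ∧ e = (i, ρ.pick i y c.targets) := by
  unfold bestEdge
  split_ifs with h
  · simp [h]
  · simp only [Finset.notMem_empty, false_iff]
    tauto

theorem mem_allBestEdges {x : Finset (R × P) × (R ⊕ P → ℝ)} {e : R × P} :
    e ∈ allBestEdges ρ x ↔ e.1 ∉ (ρ.solve x.1).robots ∧ (∃ j, j ∉ (ρ.solve x.1).targets) ∧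
      e.2 = ρ.pick e.1 x.2 (ρ.solve x.1).targets := by
  simp only [allBestEdges, Finset.mem_biUnion, Finset.mem_univ, true_and, mem_bestEdge]
  constructor
  · rintro ⟨i, h1, h2, rfl⟩
    exact ⟨h1, h2, rfl⟩
  · rintro ⟨h1, h2, h3⟩
    exact ⟨e.1, h1, h2, Prod.ext rfl h3⟩

theorem bestEdge_subset_allBestEdges (x : Finset (R × P) × (R ⊕ P → ℝ)) (i : R) :
    bestEdge ρ i x.2 (ρ.solve x.1) ⊆ allBestEdges ρ x := by
  classical
  exact Finset.subset_biUnion_of_mem (fun i => bestEdge ρ i x.2 (ρ.solve x.1)) (Finset.mem_univ i)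

-- This count is what lets a robot recognize a complete candidate set: distinct uncovered robots
-- contribute distinct edges.
open Classical in
theorem card_allBestEdges (hcard : Fintype.card R = Fintype.card P)
    {x : Finset (R × P) × (R ⊕ P → ℝ)} (hp : ¬ IsPerfectMatching (ρ.solve x.1).matching) :
    (allBestEdges ρ x).card = ((ρ.solve x.1).robotsᶜ).card := by
  have h : allBestEdges ρ x =
      ((ρ.solve x.1).robotsᶜ).image fun i => (i, ρ.pick i x.2 (ρ.solve x.1).targets) := by
    ext ⟨i, j⟩
    simp only [mem_allBestEdges, ρ.exists_notMem_targets hcard hp, true_and, Finset.mem_image,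
      Finset.mem_compl, Prod.mk.injEq]
    constructor
    · rintro ⟨h1, rfl⟩
      exact ⟨i, h1, rfl, rfl⟩
    · rintro ⟨i, h1, rfl, rfl⟩
      exact ⟨h1, rfl⟩
  rw [h]
  exact Finset.card_image_of_injective _ fun i i' h => congrArg Prod.fst h

/-- The labels after the next step of the Hungarian method. -/
noncomputable def nextLabel (x : Finset (R × P) × (R ⊕ P → ℝ)) : R ⊕ P → ℝ :=
  updateLabel x.2 (ρ.solve x.1) (minSlack A.weight x.2 (allBestEdges ρ x))

open Classical in
/-- The equality edges after the next step of the Hungarian method, before pruning. -/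
noncomputable def nextEdges (x : Finset (R × P) × (R ⊕ P → ℝ)) : Finset (R × P) :=
  (x.1 ∪ allBestEdges ρ x).filter
    fun e => nextLabel ρ x (Sum.inl e.1) + nextLabel ρ x (Sum.inr e.2) = A.weight e

/-- The next step of the Hungarian method. -/
noncomputable def nextStage (x : Finset (R × P) × (R ⊕ P → ℝ)) :
    Finset (R × P) × (R ⊕ P → ℝ) :=
  (ρ.reduce (nextEdges ρ x), nextLabel ρ x)

open Classical in
theorem mem_nextEdges {x : Finset (R × P) × (R ⊕ P → ℝ)} {e : R × P} :
    e ∈ nextEdges ρ x ↔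
      (e ∈ x.1 ∨ e ∈ allBestEdges ρ x) ∧ slack A.weight (nextLabel ρ x) e = 0 := by
  rw [nextEdges, Finset.mem_filter, Finset.mem_union, slack, sub_eq_zero]
  exact and_congr_right fun _ => eq_comm

theorem solve_nextStage (x : Finset (R × P) × (R ⊕ P → ℝ)) :
    ρ.solve (nextStage ρ x).1 = ρ.solve (nextEdges ρ x) :=
  ρ.solve_reduce _

/-- The labels `x.2` form a feasible dual solution, and the edges `x.1` are tight. -/
structure IsDualFeasible (A : AssignmentProblem R P) (x : Finset (R × P) × (R ⊕ P → ℝ)) :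
    Prop where
  slack_nonneg : ∀ e, 0 ≤ slack A.weight x.2 e
  slack_eq_zero : ∀ e ∈ x.1, slack A.weight x.2 e = 0

theorem exists_mem_minSlack_eq (w : R × P → ℝ) (y : R ⊕ P → ℝ) {cand : Finset (R × P)}
    (h : cand.Nonempty) : ∃ e ∈ cand, slack w y e = minSlack w y cand := by
  rw [minSlack, dif_pos h]
  obtain ⟨e, he, h'⟩ := Finset.exists_mem_eq_inf' h (slack w y)
  exact ⟨e, he, h'.symm⟩

theorem minSlack_le (w : R × P → ℝ) (y : R ⊕ P → ℝ) {cand : Finset (R × P)} {e : R × P}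
    (he : e ∈ cand) : minSlack w y cand ≤ slack w y e := by
  rw [minSlack, dif_pos ⟨e, he⟩]
  exact Finset.inf'_le _ he

/-- One edge per robot suffices to compute `δ`, since each robot offers its minimum over all
uncovered targets. -/
theorem minSlack_allBestEdges_le {x : Finset (R × P) × (R ⊕ P → ℝ)} {e : R × P}
    (h1 : e.1 ∉ (ρ.solve x.1).robots) (h2 : e.2 ∉ (ρ.solve x.1).targets) :
    minSlack A.weight x.2 (allBestEdges ρ x) ≤ slack A.weight x.2 e :=
  (minSlack_le _ _ (e := (e.1, ρ.pick e.1 x.2 (ρ.solve x.1).targets))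
    ((mem_allBestEdges ρ).2 ⟨h1, ⟨_, h2⟩, rfl⟩)).trans (ρ.pick_min _ _ _ _ h2)

theorem allBestEdges_nonempty (hcard : Fintype.card R = Fintype.card P)
    {x : Finset (R × P) × (R ⊕ P → ℝ)} (hp : ¬ IsPerfectMatching (ρ.solve x.1).matching) :
    (allBestEdges ρ x).Nonempty := by
  obtain ⟨i, hi⟩ := ρ.exists_notMem_robots hcard hp
  exact ⟨(i, ρ.pick i x.2 (ρ.solve x.1).targets), (mem_allBestEdges ρ).2
    ⟨hi, ρ.exists_notMem_targets hcard hp, rfl⟩⟩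

-- Only two kinds of edges change: those covered twice gain `δ`, those not covered at all lose `δ`.
open Classical in
theorem slack_updateLabel (w : R × P → ℝ) (y : R ⊕ P → ℝ) (c : MatchingAndCover R P) (δ : ℝ)
    (e : R × P) : slack w (updateLabel y c δ) e =
      slack w y e + (if e.1 ∈ c.robots then δ else 0) - (if e.2 ∈ c.targets then 0 else δ) := by
  simp only [slack, updateLabel, Sum.elim_inl, Sum.elim_inr]
  split_ifs <;> ring

theorem slack_nextLabel_eq {x : Finset (R × P) × (R ⊕ P → ℝ)} {e : R × P}
    (h : e.1 ∈ (ρ.solve x.1).robots ↔ e.2 ∉ (ρ.solve x.1).targets) :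
    slack A.weight (nextLabel ρ x) e = slack A.weight x.2 e := by
  rw [nextLabel, slack_updateLabel]
  by_cases h1 : e.2 ∈ (ρ.solve x.1).targets <;> simp [h, h1]

theorem IsDualFeasible.minSlack_nonneg (hcard : Fintype.card R = Fintype.card P)
    {x : Finset (R × P) × (R ⊕ P → ℝ)} (hx : IsDualFeasible A x)
    (hp : ¬ IsPerfectMatching (ρ.solve x.1).matching) :
    0 ≤ minSlack A.weight x.2 (allBestEdges ρ x) := by
  obtain ⟨e, -, he⟩ := exists_mem_minSlack_eq A.weight x.2 (allBestEdges_nonempty ρ hcard hp)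
  rw [← he]
  exact hx.slack_nonneg e

/-- Slack decreases only between uncovered vertices, and there `δ` is a lower bound for it. -/
theorem IsDualFeasible.nextStage (hcard : Fintype.card R = Fintype.card P)
    {x : Finset (R × P) × (R ⊕ P → ℝ)} (hx : IsDualFeasible A x)
    (hp : ¬ IsPerfectMatching (ρ.solve x.1).matching) : IsDualFeasible A (nextStage ρ x) where
  slack_nonneg e := by
    have h := hx.slack_nonneg e
    have hδ := hx.minSlack_nonneg ρ hcard hp
    change 0 ≤ slack A.weight (nextLabel ρ x) e
    rw [nextLabel, slack_updateLabel]
    split_ifs with h1 h2 h2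
    · linarith
    · linarith
    · linarith
    · linarith [minSlack_allBestEdges_le ρ h1 h2]
  slack_eq_zero e he := ((mem_nextEdges ρ).1 (ρ.reduce_subset _ he)).2

theorem matching_subset_nextEdges {x : Finset (R × P) × (R ⊕ P → ℝ)} (hx : IsDualFeasible A x) :
    (ρ.solve x.1).matching ⊆ nextEdges ρ x := by
  intro e he
  have h := ρ.matching_subset _ he
  rw [mem_nextEdges, slack_nextLabel_eq ρ (ρ.robots_iff_notMem_targets he)]
  exact ⟨Or.inl h, hx.slack_eq_zero e h⟩

theorem mem_nextEdges_of_mem {x : Finset (R × P) × (R ⊕ P → ℝ)} (hx : IsDualFeasible A x) :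
    ∀ e ∈ x.1, ¬ (e.1 ∈ (ρ.solve x.1).robots ∧ e.2 ∈ (ρ.solve x.1).targets) →
      e ∈ nextEdges ρ x := by
  intro e he h
  have h' := ρ.isVertexCover _ e he
  rw [mem_nextEdges, slack_nextLabel_eq ρ (by tauto)]
  exact ⟨Or.inl he, hx.slack_eq_zero e he⟩

/-- A candidate that attains `δ` becomes tight; it is the edge that drives progress. -/
theorem exists_mem_nextEdges (hcard : Fintype.card R = Fintype.card P)
    {x : Finset (R × P) × (R ⊕ P → ℝ)} (hp : ¬ IsPerfectMatching (ρ.solve x.1).matching) :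
    ∃ e ∈ nextEdges ρ x, e.1 ∉ (ρ.solve x.1).robots ∧ e.2 ∉ (ρ.solve x.1).targets := by
  obtain ⟨e, he, h⟩ := exists_mem_minSlack_eq A.weight x.2 (allBestEdges_nonempty ρ hcard hp)
  obtain ⟨h1, h2, h3⟩ := (mem_allBestEdges ρ).1 he
  have h4 : e.2 ∉ (ρ.solve x.1).targets := by
    rw [h3]
    exact ρ.pick_not_mem _ _ _ h2
  refine ⟨e, (mem_nextEdges ρ).2 ⟨Or.inr he, ?_⟩, h1, h4⟩
  rw [nextLabel, slack_updateLabel, if_neg h1, if_neg h4, h]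
  ring

/-- A bounded measure that grows with every step of the Hungarian method. -/
theorem exists_progress_measure (hcard : Fintype.card R = Fintype.card P) :
    ∃ (μ : MatchingAndCover R P → ℕ) (b : ℕ), (∀ E, μ (ρ.solve E) ≤ b) ∧
      ∀ x, IsDualFeasible A x → ¬ IsPerfectMatching (ρ.solve x.1).matching →
        μ (ρ.solve x.1) < μ (ρ.solve (nextStage ρ x).1) := by
  set r := Fintype.card R
  have bound : ∀ E, (ρ.solve E).matching.card * (r + 1) ≤ r * (r + 1) := fun E =>
    Nat.mul_le_mul_right _ (ρ.isMatching E).card_le_robots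
  -- The lexicographic order, encoded in base `r + 1` because the second entry is at most `r`.
  have lex : ∀ {m m' a a' : ℕ}, a ≤ r → m < m' ∨ m = m' ∧ a < a' →
      m * (r + 1) + a < m' * (r + 1) + a' := by
    rintro m m' a a' ha (h | ⟨rfl, h⟩)
    · nlinarith
    · omega
  rcases ρ.solve_cover with hc | hc
  · refine ⟨fun c => c.matching.card * (r + 1) + c.robots.card, r * (r + 1) + r,
      fun E => add_le_add (bound E) (Finset.card_le_univ _), fun x hx hp => ?_⟩
    obtain ⟨e, he, h1, h2⟩ := exists_mem_nextEdges ρ hcard hp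
    rw [solve_nextStage]
    exact lex (Finset.card_le_univ _) ((hc _).progress (hc _) (ρ.solve_matching _)
      (ρ.solve_matching _) (matching_subset_nextEdges ρ hx) (mem_nextEdges_of_mem ρ hx) he h1 h2)
  · refine ⟨fun c => c.matching.card * (r + 1) + c.targets.card, r * (r + 1) + r,
      fun E => add_le_add (bound E) ((Finset.card_le_univ _).trans hcard.ge), fun x hx hp => ?_⟩
    obtain ⟨e, he, h1, h2⟩ := exists_mem_nextEdges ρ hcard hp
    rw [solve_nextStage]
    exact lex ((Finset.card_le_univ _).trans hcard.ge) ((hc _).progress (hc _)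
      (ρ.solve_matching _) (ρ.solve_matching _) (matching_subset_nextEdges ρ hx)
      (mem_nextEdges_of_mem ρ hx) he h1 h2)

open Classical in
/-- The equality edges and labels with which the Hungarian method starts if robot `i` starts with
the edge `(i, j₀ i)`. -/
noncomputable def initialStage (A : AssignmentProblem R P) (j₀ : R → P) :
    Finset (R × P) × (R ⊕ P → ℝ) :=
  (Finset.univ.image fun i => (i, j₀ i), Sum.elim (fun i => A.weight (i, j₀ i)) fun _ => 0)

theorem mem_initialStage {j₀ : R → P} {e : R × P} :
    e ∈ (initialStage A j₀).1 ↔ e.2 = j₀ e.1 := by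
  simp only [initialStage, Finset.mem_image, Finset.mem_univ, true_and]
  constructor
  · rintro ⟨i, rfl⟩
    rfl
  · exact fun h => ⟨e.1, Prod.ext rfl h.symm⟩

theorem card_initialStage (A : AssignmentProblem R P) (j₀ : R → P) :
    (initialStage A j₀).1.card = Fintype.card R := by
  classical
  exact (Finset.card_image_of_injective _ fun i i' h => congrArg Prod.fst h).trans Finset.card_univ

theorem isDualFeasible_initialStage {j₀ : R → P}
    (h : ∀ i j, A.weight (i, j₀ i) ≤ A.weight (i, j)) :
    IsDualFeasible A (initialStage A j₀) where
  slack_nonneg e := by simpa [slack, initialStage] using h e.1 e.2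
  slack_eq_zero e he := by
    have h1 : e = (e.1, j₀ e.1) := Prod.ext rfl (mem_initialStage.1 he)
    rw [h1]
    simp [slack, initialStage]

/-- The sequence of equality edges and labels that the Hungarian method passes through. -/
noncomputable def stage (j₀ : R → P) (n : ℕ) : Finset (R × P) × (R ⊕ P → ℝ) :=
  (nextStage ρ)^[n] (initialStage A j₀)

theorem stage_succ (j₀ : R → P) (n : ℕ) : stage ρ j₀ (n + 1) = nextStage ρ (stage ρ j₀ n) :=
  Function.iterate_succ_apply' _ _ _

theorem isDualFeasible_stage (hcard : Fintype.card R = Fintype.card P) {j₀ : R → P}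
    (h : ∀ i j, A.weight (i, j₀ i) ≤ A.weight (i, j)) {n : ℕ}
    (hp : ∀ m < n, ¬ IsPerfectMatching (ρ.solve (stage ρ j₀ m).1).matching) :
    IsDualFeasible A (stage ρ j₀ n) := by
  induction n with
  | zero => exact isDualFeasible_initialStage h
  | succ n ih =>
    rw [stage_succ]
    exact (ih fun m hm => hp m (by omega)).nextStage ρ hcard (hp n n.lt_succ_self)

theorem exists_stage_bound (hcard : Fintype.card R = Fintype.card P) {j₀ : R → P}
    (h : ∀ i j, A.weight (i, j₀ i) ≤ A.weight (i, j)) :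
    ∃ b : ℕ, ∀ n, (∀ m < n, ¬ IsPerfectMatching (ρ.solve (stage ρ j₀ m).1).matching) → n ≤ b := by
  obtain ⟨μ, b, hb, hμ⟩ := exists_progress_measure ρ hcard
  -- The measure gains at least one at each stage without a perfect matching, so it is at least `n`
  -- at stage `n`.
  refine ⟨b, fun n hp => le_trans ?_ (hb (stage ρ j₀ n).1)⟩
  induction n with
  | zero => exact Nat.zero_le _
  | succ n ih =>
    have h1 := ih fun m hm => hp m (by omega)
    have h2 := hμ _ (isDualFeasible_stage ρ hcard h fun m hm => hp m (by omega))
      (hp n n.lt_succ_self)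
    rw [stage_succ]
    omega

end Stages

/-! ### The invariant and its preservation by merging and by local steps -/

section States

variable {R P : Type*} [Fintype R] [Fintype P] {A : AssignmentProblem R P} (ρ : Routines A)

/-- The states that occur: before all initial edges are known the equality edges are some of them,
afterwards the counter determines the equality edges and labels. -/
structure IsConsistent (j₀ : R → P) (g : State R P) : Prop where
  weight_eq : ∀ e, e ∈ g.eqEdges ∨ e ∈ g.candEdges → g.weight e = A.weight e
  stage_eq : (g.counter = -1 ∧ g.eqEdges ⊆ (initialStage A j₀).1 ∧ g.candEdges = ∅) ∨
    ∃ n : ℕ, g.counter = n ∧ (g.eqEdges, g.label) = stage ρ j₀ n ∧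
      g.candEdges ⊆ allBestEdges ρ (stage ρ j₀ n) ∧
      ∀ m < n, ¬ IsPerfectMatching (ρ.solve (stage ρ j₀ m).1).matching

variable {ρ} {j₀ : R → P}

theorem IsConsistent.neg_one_le {g : State R P} (hg : IsConsistent ρ j₀ g) :
    -1 ≤ g.counter := by
  rcases hg.stage_eq with h | ⟨n, h, -⟩ <;> omega

theorem IsConsistent.of_counter_eq_neg_one {g : State R P} (hg : IsConsistent ρ j₀ g)
    (h : g.counter = -1) : g.eqEdges ⊆ (initialStage A j₀).1 ∧ g.candEdges = ∅ := by
  rcases hg.stage_eq with h' | ⟨n, h', -⟩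
  · exact h'.2
  · omega

theorem IsConsistent.of_counter_eq {g : State R P} (hg : IsConsistent ρ j₀ g) {n : ℕ}
    (h : g.counter = n) : (g.eqEdges, g.label) = stage ρ j₀ n ∧
      g.candEdges ⊆ allBestEdges ρ (stage ρ j₀ n) ∧
      ∀ m < n, ¬ IsPerfectMatching (ρ.solve (stage ρ j₀ m).1).matching := by
  rcases hg.stage_eq with h' | ⟨m, h', h''⟩
  · omega
  · obtain rfl : n = m := by omega
    exact h''

theorem WeightsFrom.weight_eq {L : Finset R} {S : R → State R P} {g : State R P}
    (h : WeightsFrom L S g) (hS : ∀ j, IsConsistent ρ j₀ (S j)) :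
    ∀ e, e ∈ g.eqEdges ∨ e ∈ g.candEdges → g.weight e = A.weight e := by
  intro e he
  obtain ⟨j, -, hj, hw⟩ := h e he
  rw [hw, (hS j).weight_eq e hj]

/-- The merged edges lie in the initial stage, which has `r` edges. Collecting `r` of them means
having all, so the counter becomes `0` only at stage `0`. -/
theorem MergeInitial.isConsistent {N : Finset R} {S : R → State R P} {g : State R P}
    (hS : ∀ j, IsConsistent ρ j₀ (S j)) (hN : ∀ j ∈ N, (S j).counter = -1)
    (hg : MergeInitial N S g) : IsConsistent ρ j₀ g := by
  obtain ⟨hE, hC, hW, hl, hl0, hlP, hγ⟩ := hg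
  have hw := hW.weight_eq hS
  have hsub : g.eqEdges ⊆ (initialStage A j₀).1 := by
    classical
    rw [hE, Finset.biUnion_subset]
    exact fun j hj => ((hS j).of_counter_eq_neg_one (hN j hj)).1
  refine ⟨hw, ?_⟩
  split_ifs at hγ with hcard
  · have heq : g.eqEdges = (initialStage A j₀).1 :=
      Finset.eq_of_subset_of_card_le hsub (by rw [card_initialStage, hcard])
    refine Or.inr ⟨0, hγ, Prod.ext heq (funext ?_), by simp [hC], by simp⟩
    rintro (i | j)
    · have hi : (i, j₀ i) ∈ g.eqEdges := heq ▸ mem_initialStage.2 rfl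
      exact (hl _ hi).trans (hw _ (Or.inl hi))
    · exact hlP j
  · exact Or.inl ⟨hγ, hsub, hC⟩

theorem mem_leaders {N : Finset R} {S : R → State R P} {j : R} :
    j ∈ leaders N S ↔ j ∈ N ∧ ∀ k ∈ N, (S k).counter ≤ (S j).counter := by
  rw [leaders, Finset.mem_filter]

theorem MergeLeaders.counter_eq {N : Finset R} {S : R → State R P} {g : State R P}
    (hg : MergeLeaders N S g) {j : R} (hj : j ∈ leaders N S) : (S j).counter = g.counter := by
  obtain ⟨⟨l, hl, hγ, -⟩, -⟩ := hg
  rw [mem_leaders] at hj hl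
  rw [hγ]
  exact le_antisymm (hl.2 j hj.1) (hj.2 l hl.1)

theorem MergeLeaders.le_counter {N : Finset R} {S : R → State R P} {g : State R P}
    (hg : MergeLeaders N S g) {j : R} (hj : j ∈ N) : (S j).counter ≤ g.counter := by
  obtain ⟨⟨l, hl, hγ, -⟩, -⟩ := hg
  rw [mem_leaders] at hl
  rw [hγ]
  exact hl.2 j hj

theorem MergeLeaders.counter_nonneg {N : Finset R} {S : R → State R P} {g : State R P}
    (hS : ∀ j, IsConsistent ρ j₀ (S j)) (hN : ¬ ∀ j ∈ N, (S j).counter = -1)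
    (hg : MergeLeaders N S g) : 0 ≤ g.counter := by
  push Not at hN
  obtain ⟨j, hj, hne⟩ := hN
  have h1 := (hS j).neg_one_le
  have h2 := hg.le_counter hj
  omega

/-- All leaders have the same counter and hence the same stage, so it does not matter whose labels
are copied, and their candidates may be united. -/
theorem MergeLeaders.isConsistent {N : Finset R} {S : R → State R P} {g : State R P}
    (hS : ∀ j, IsConsistent ρ j₀ (S j)) (hN : ¬ ∀ j ∈ N, (S j).counter = -1)
    (hg : MergeLeaders N S g) : IsConsistent ρ j₀ g := by
  have h0 := hg.counter_nonneg hS hN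
  have hlead := fun {j} => hg.counter_eq (j := j)
  obtain ⟨⟨l, hl, hγ, hy, hE⟩, hC, hW⟩ := hg
  refine ⟨hW.weight_eq hS, Or.inr ?_⟩
  obtain ⟨n, hn⟩ := Int.eq_ofNat_of_zero_le h0
  obtain ⟨h1, -, h2⟩ := (hS l).of_counter_eq ((hlead hl).trans hn)
  refine ⟨n, hn, by rw [hE, hy, h1], ?_, h2⟩
  classical
  rw [hC, Finset.biUnion_subset]
  exact fun j hj => ((hS j).of_counter_eq ((hlead hj).trans hn)).2.1

theorem BuildLatestGraph.isConsistent {N : Finset R} {S : R → State R P} {g : State R P}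
    (hS : ∀ j, IsConsistent ρ j₀ (S j)) (hg : BuildLatestGraph N S g) : IsConsistent ρ j₀ g := by
  rcases hg with ⟨h, hg⟩ | ⟨h, hg⟩
  · exact hg.isConsistent hS h
  · exact hg.isConsistent hS h

theorem BuildLatestGraph.le_counter {N : Finset R} {S : R → State R P} {g : State R P}
    (hg : BuildLatestGraph N S g) {j : R} (hj : j ∈ N) : (S j).counter ≤ g.counter := by
  rcases hg with ⟨h, hg⟩ | ⟨h, hg⟩
  · obtain ⟨-, -, -, -, -, -, hγ⟩ := hg
    rw [h j hj, hγ]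
    split_ifs <;> omega
  · exact hg.le_counter hj

theorem BuildLatestGraph.mergeInitial {N : Finset R} {S : R → State R P} {g : State R P}
    (hS : ∀ j, IsConsistent ρ j₀ (S j)) (hg : BuildLatestGraph N S g) (h : g.counter = -1) :
    (∀ j ∈ N, (S j).counter = -1) ∧ MergeInitial N S g := by
  rcases hg with hg | ⟨hN, hg⟩
  · exact hg
  · have := hg.counter_nonneg hS hN
    omega

/-- With equal counters everybody is a leader, so no candidate is lost in the merge; this is how
candidates spread. -/
theorem BuildLatestGraph.candEdges_subset {N : Finset R} {S : R → State R P} {g : State R P}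
    (hS : ∀ j, IsConsistent ρ j₀ (S j)) (hg : BuildLatestGraph N S g)
    (h : ∀ j ∈ N, (S j).counter = g.counter) {j : R} (hj : j ∈ N) :
    (S j).candEdges ⊆ g.candEdges := by
  rcases hg with ⟨hN, -⟩ | ⟨-, -, hC, -⟩
  · rw [((hS j).of_counter_eq_neg_one (hN j hj)).2]
    exact Finset.empty_subset _
  · rw [hC]
    classical
    refine Finset.subset_biUnion_of_mem (fun j => (S j).candEdges) ?_
    exact mem_leaders.2 ⟨hj, fun k hk => by rw [h k hk, h j hj]⟩

open Classical in
/-- The temporary state after robot `i` has added its best edge. -/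
noncomputable def addBestEdge (ρ : Routines A) (i : R) (g : State R P) : State R P :=
  { eqEdges := g.eqEdges
    candEdges := g.candEdges ∪ bestEdge ρ i g.label (ρ.solve g.eqEdges)
    weight := addWeights A g.weight (bestEdge ρ i g.label (ρ.solve g.eqEdges))
    label := g.label
    counter := g.counter }

theorem localHungarian_of_perfect {i : R} {g : State R P}
    (h : IsPerfectMatching (ρ.solve g.eqEdges).matching) : localHungarian ρ i g = g := by
  rw [localHungarian, if_pos h]

open Classical in
theorem localHungarian_of_not_perfect {i : R} {g : State R P}
    (h : ¬ IsPerfectMatching (ρ.solve g.eqEdges).matching) : localHungarian ρ i g =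
      if ((ρ.solve g.eqEdges).robotsᶜ).card = (addBestEdge ρ i g).candEdges.card then
        advance ρ i (addBestEdge ρ i g) (ρ.solve g.eqEdges) else addBestEdge ρ i g := by
  rw [localHungarian, if_neg h]
  rfl

theorem addWeights_eq {w : R × P → ℝ} {new : Finset (R × P)} {e : R × P}
    (h : w e = A.weight e) : addWeights A w new e = A.weight e := by
  rw [addWeights, h, ite_self]

theorem addWeights_eq_of_mem {w : R × P → ℝ} {new : Finset (R × P)} {e : R × P}
    (h : e ∈ new) : addWeights A w new e = A.weight e := by
  rw [addWeights, if_pos h]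

theorem IsConsistent.isConsistent_addBestEdge {g : State R P} (hg : IsConsistent ρ j₀ g) (i : R)
    (h0 : 0 ≤ g.counter) : IsConsistent ρ j₀ (addBestEdge ρ i g) := by
  classical
  obtain ⟨n, hn⟩ := Int.eq_ofNat_of_zero_le h0
  obtain ⟨h1, h2, h3⟩ := hg.of_counter_eq hn
  refine ⟨?_, Or.inr ⟨n, hn, h1, Finset.union_subset h2 ?_, h3⟩⟩
  · rintro e (he | he)
    · exact addWeights_eq (hg.weight_eq e (Or.inl he))
    · rcases Finset.mem_union.1 he with he | he
      · exact addWeights_eq (hg.weight_eq e (Or.inr he))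
      · exact addWeights_eq_of_mem he
  · rw [← h1]
    exact bestEdge_subset_allBestEdges ρ (g.eqEdges, g.label) i

theorem minSlack_congr {w w' : R × P → ℝ} {y : R ⊕ P → ℝ} {cand : Finset (R × P)}
    (h : ∀ e ∈ cand, w e = w' e) : minSlack w y cand = minSlack w' y cand := by
  unfold minSlack
  split_ifs with hne
  · exact Finset.inf'_congr hne rfl fun e he => by rw [slack, slack, h e he]
  · rfl

/-- With a complete set of candidate edges, a robot performs one step of the Hungarian method. -/
theorem IsConsistent.advance_eq {g : State R P} (hg : IsConsistent ρ j₀ g) (i : R)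
    (hC : g.candEdges = allBestEdges ρ (g.eqEdges, g.label)) :
    ((advance ρ i g (ρ.solve g.eqEdges)).eqEdges, (advance ρ i g (ρ.solve g.eqEdges)).label) =
      nextStage ρ (g.eqEdges, g.label) := by
  have hδ : minSlack g.weight g.label g.candEdges =
      minSlack A.weight g.label (allBestEdges ρ (g.eqEdges, g.label)) := by
    rw [← hC]
    exact minSlack_congr fun e he => hg.weight_eq e (Or.inr he)
  have hy : updateLabel g.label (ρ.solve g.eqEdges) (minSlack g.weight g.label g.candEdges) =
      nextLabel ρ (g.eqEdges, g.label) := by rw [hδ]; rfl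
  simp only [advance, nextStage, hy, Prod.mk.injEq, and_true]
  congr 1
  classical
  ext e
  rw [nextEdges, ← hC, Finset.mem_filter, Finset.mem_filter]
  exact and_congr_right fun he => by rw [hg.weight_eq e (Finset.mem_union.1 he)]

theorem IsConsistent.isConsistent_advance {g : State R P} (hg : IsConsistent ρ j₀ g) (i : R)
    (h0 : 0 ≤ g.counter) (hp : ¬ IsPerfectMatching (ρ.solve g.eqEdges).matching)
    (hC : g.candEdges = allBestEdges ρ (g.eqEdges, g.label)) :
    IsConsistent ρ j₀ (advance ρ i g (ρ.solve g.eqEdges)) := by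
  classical
  obtain ⟨n, hn⟩ := Int.eq_ofNat_of_zero_le h0
  obtain ⟨h1, -, h3⟩ := hg.of_counter_eq hn
  have hnext := hg.advance_eq i hC
  rw [h1, ← stage_succ] at hnext
  -- The robot finds its best edge before pruning, whereas the stage is pruned; `solve_reduce` makes
  -- both covers agree.
  have hnew : (advance ρ i g (ρ.solve g.eqEdges)).candEdges =
      bestEdge ρ i (stage ρ j₀ (n + 1)).2 (ρ.solve (stage ρ j₀ (n + 1)).1) := by
    rw [← hnext]
    simp only [advance, ρ.solve_reduce]
  refine ⟨?_, Or.inr ⟨n + 1, ?_, hnext, ?_, ?_⟩⟩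
  · rintro e (he | he)
    · have he' := ρ.reduce_subset _ he
      rw [Finset.mem_filter, Finset.mem_union] at he'
      exact addWeights_eq (hg.weight_eq e he'.1)
    · exact addWeights_eq_of_mem he
  · change g.counter + 1 = _
    rw [hn]
    push_cast
    rfl
  · rw [hnew]
    exact bestEdge_subset_allBestEdges ρ _ i
  · intro m hm
    rcases Nat.lt_succ_iff_lt_or_eq.1 hm with hm | rfl
    · exact h3 m hm
    · rw [← h1]
      exact hp

/-- The invariant makes the candidates a subset of the full set, so the robot's purely numerical
test proves equality. -/
theorem IsConsistent.candEdges_eq {g : State R P}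
    (hg : IsConsistent ρ j₀ g) (h0 : 0 ≤ g.counter) {m : ℕ}
    (hm : (allBestEdges ρ (g.eqEdges, g.label)).card = m) (hC : m = g.candEdges.card) :
    g.candEdges = allBestEdges ρ (g.eqEdges, g.label) := by
  obtain ⟨n, hn⟩ := Int.eq_ofNat_of_zero_le h0
  obtain ⟨h1, h2, -⟩ := hg.of_counter_eq hn
  rw [← h1] at h2
  exact Finset.eq_of_subset_of_card_le h2 (by rw [hm, hC])

theorem IsConsistent.isConsistent_localHungarian (hcard : Fintype.card R = Fintype.card P)
    {g : State R P} (hg : IsConsistent ρ j₀ g) (i : R) (h0 : 0 ≤ g.counter) :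
    IsConsistent ρ j₀ (localHungarian ρ i g) := by
  by_cases hp : IsPerfectMatching (ρ.solve g.eqEdges).matching
  · rwa [localHungarian_of_perfect hp]
  have hg' := hg.isConsistent_addBestEdge i h0
  rw [localHungarian_of_not_perfect hp]
  split_ifs with h
  · exact hg'.isConsistent_advance i h0 hp (hg'.candEdges_eq h0
      (card_allBestEdges ρ hcard (x := (g.eqEdges, g.label)) hp) h)
  · exact hg'

theorem le_counter_localHungarian (i : R) (g : State R P) :
    g.counter ≤ (localHungarian ρ i g).counter := by
  by_cases hp : IsPerfectMatching (ρ.solve g.eqEdges).matching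
  · rw [localHungarian_of_perfect hp]
  rw [localHungarian_of_not_perfect hp]
  split_ifs with h
  · change g.counter ≤ g.counter + 1
    omega
  · exact le_rfl

/-- If the counter does not change, then the robot has added its best edge, and the candidate edges
are still incomplete. -/
theorem localHungarian_of_counter_eq (hcard : Fintype.card R = Fintype.card P) {i : R}
    {g : State R P} (hp : ¬ IsPerfectMatching (ρ.solve g.eqEdges).matching)
    (h : (localHungarian ρ i g).counter = g.counter) :
    localHungarian ρ i g = addBestEdge ρ i g ∧
      (addBestEdge ρ i g).candEdges ≠ allBestEdges ρ (g.eqEdges, g.label) := by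
  rw [localHungarian_of_not_perfect hp] at h ⊢
  split_ifs at h ⊢ with h'
  · change g.counter + 1 = g.counter at h
    omega
  · refine ⟨rfl, fun hC => h' ?_⟩
    rw [hC]
    exact (card_allBestEdges ρ hcard (x := (g.eqEdges, g.label)) hp).symm

end States

/-! ### Stabilization of executions over strongly connected digraphs -/

section Executions

/-- Values that grow along the arcs of strongly connected digraphs, within a finite set, are
eventually constant and equal at all vertices. -/
theorem exists_forall_ge_eq {ι α : Type*} [Finite ι] [PartialOrder α] {S : Set α}
    (hS : S.Finite) {D : ℕ → Digraph ι} (hD : ∀ k, StronglyConnected (D k)) {f : ℕ → ι → α}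
    (hf : ∀ k i, f k i ∈ S) (hself : ∀ k i, f k i ≤ f (k + 1) i)
    (hadj : ∀ k i j, (D k).Adj j i → f k j ≤ f (k + 1) i) :
    ∃ K, ∀ k ≥ K, ∀ i j, f k i = f K j := by
  have := hS.to_subtype
  -- The values at all vertices together form one increasing sequence in a finite order.
  let F : ℕ →o (ι → S) :=
    ⟨fun k i => ⟨f k i, hf k i⟩, monotone_nat_of_le_succ fun k i => hself k i⟩
  obtain ⟨K, hK⟩ := WellFoundedGT.monotone_chain_condition F
  have hconst : ∀ k ≥ K, ∀ i, f k i = f K i := fun k hk i =>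
    (congrArg Subtype.val (congrFun (hK k hk) i)).symm
  -- Once the values are constant, each arc of the single digraph `D K` gives an inequality between
  -- them; directed paths both ways give equality.
  have hle : ∀ j i, f K j ≤ f K i := by
    intro j i
    induction hD K j i with
    | refl => exact le_rfl
    | @tail l m _ hlm ih =>
      exact ih.trans ((hadj K m l hlm).trans_eq (hconst (K + 1) K.le_succ m))
  exact ⟨K, fun k hk i j => (hconst k hk i).trans ((hle i j).antisymm (hle j i))⟩

variable {R P : Type*} [Fintype R] [Fintype P] {A : AssignmentProblem R P} {ρ : Routines A}
  {G : ℝ≥0 → Digraph R} {τ : ℕ → ℝ≥0} {s : ℕ → R → State R P} {j₀ : R → P}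

theorem mem_inNeighborhood {D : Digraph R} {i j : R} :
    j ∈ inNeighborhood D i ↔ j = i ∨ D.Adj j i := by
  simp [inNeighborhood]

theorem self_mem_inNeighborhood (D : Digraph R) (i : R) : i ∈ inNeighborhood D i :=
  mem_inNeighborhood.2 (Or.inl rfl)

theorem IsExecution.le_counter (hs : IsExecution ρ G τ s) {k : ℕ} {i j : R}
    (hj : j ∈ inNeighborhood (G (τ k)) i) : (s k j).counter ≤ (s (k + 1) i).counter := by
  obtain ⟨g, hg, hpos, hneg⟩ := hs.step k i
  refine (hg.le_counter hj).trans ?_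
  rcases lt_or_ge g.counter 0 with h | h
  · rw [hneg h]
  · rw [hpos h]
    exact le_counter_localHungarian i g

theorem IsExecution.isConsistent (hs : IsExecution ρ G τ s)
    (hcard : Fintype.card R = Fintype.card P) (h0 : ∀ i, IsConsistent ρ j₀ (s 0 i)) (k : ℕ) :
    ∀ i, IsConsistent ρ j₀ (s k i) := by
  induction k with
  | zero => exact h0
  | succ k ih =>
    intro i
    obtain ⟨g, hg, hpos, hneg⟩ := hs.step k i
    have hg' := hg.isConsistent ih
    rcases lt_or_ge g.counter 0 with h | h
    · rwa [hneg h]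
    · rw [hpos h]
      exact hg'.isConsistent_localHungarian hcard i h

/-- Counters do not decrease, so a robot still at `-1` has received only `-1` and has run no local
step. -/
theorem IsExecution.of_counter_eq_neg_one (hs : IsExecution ρ G τ s)
    (hc : ∀ k i, IsConsistent ρ j₀ (s k i)) {k : ℕ} {i : R}
    (h : (s (k + 1) i).counter = -1) :
    (∀ j ∈ inNeighborhood (G (τ k)) i, (s k j).counter = -1) ∧
      MergeInitial (inNeighborhood (G (τ k)) i) (s k) (s (k + 1) i) := by
  obtain ⟨g, hg, hpos, hneg⟩ := hs.step k i
  rcases lt_or_ge g.counter 0 with h' | h'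
  · have hg' := hg
    rw [← hneg h'] at hg'
    exact hg'.mergeInitial (hc k) h
  · have := le_counter_localHungarian (ρ := ρ) i g
    rw [← hpos h'] at this
    omega

theorem IsExecution.mem_eqEdges_of_counter_eq_neg_one (hs : IsExecution ρ G τ s)
    (hc : ∀ k i, IsConsistent ρ j₀ (s k i)) (h0 : ∀ i, (i, j₀ i) ∈ (s 0 i).eqEdges) {k : ℕ}
    {i : R} (h : (s k i).counter = -1) : (i, j₀ i) ∈ (s k i).eqEdges := by
  classical
  induction k with
  | zero => exact h0 i
  | succ k ih =>
    obtain ⟨h1, hE, -⟩ := hs.of_counter_eq_neg_one hc h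
    have hi := self_mem_inNeighborhood (G (τ k)) i
    rw [hE]
    exact Finset.mem_biUnion.2 ⟨i, hi, ih (h1 i hi)⟩

/-- The counters do not remain at `-1`. -/
theorem IsExecution.not_forall_counter_eq_neg_one [Nonempty R] (hs : IsExecution ρ G τ s)
    (hG : ∀ t, StronglyConnected (G t)) (hc : ∀ k i, IsConsistent ρ j₀ (s k i))
    (h0 : ∀ i, (i, j₀ i) ∈ (s 0 i).eqEdges) (K : ℕ) :
    ¬ ∀ k ≥ K, ∀ i, (s k i).counter = -1 := by
  classical
  intro h
  have hmono : ∀ k i j, j ∈ inNeighborhood (G (τ (K + k))) i →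
      (s (K + k) j).eqEdges ⊆ (s (K + (k + 1)) i).eqEdges := by
    intro k i j hj
    obtain ⟨-, hE, -⟩ := hs.of_counter_eq_neg_one hc (h (K + k + 1) (by omega) i)
    rw [← Nat.add_assoc, hE]
    exact Finset.subset_biUnion_of_mem (fun j => (s (K + k) j).eqEdges) hj
  -- While the counters stay at `-1`, edge sets grow along arcs, so they end up equal. Each contains
  -- its owner's initial edge, so each is the whole initial stage, whose size would have set the
  -- counter to `0`.
  obtain ⟨L, hL⟩ := exists_forall_ge_eq (S := Set.univ) Set.finite_univ
    (fun k => hG (τ (K + k))) (f := fun k i => (s (K + k) i).eqEdges) (fun _ _ => trivial)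
    (fun k i => hmono k i i (self_mem_inNeighborhood _ _))
    (fun k i j hj => hmono k i j (mem_inNeighborhood.2 (Or.inr hj)))
  obtain ⟨i⟩ := ‹Nonempty R›
  have hfull : (s (K + (L + 1)) i).eqEdges = (initialStage A j₀).1 := by
    refine ((hc _ i).of_counter_eq_neg_one (h _ (by omega) i)).1.antisymm ?_
    rintro ⟨l, j⟩ hlj
    obtain rfl : j = j₀ l := mem_initialStage.1 hlj
    have h1 := (hL (L + 1) (by omega) i l).trans (hL (L + 1) (by omega) l l).symm
    rw [h1]
    exact hs.mem_eqEdges_of_counter_eq_neg_one hc h0 (h _ (by omega) l)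
  have hcount := h (K + L + 1) (by omega) i
  obtain ⟨-, -, -, -, -, -, -, hγ⟩ := hs.of_counter_eq_neg_one hc hcount
  rw [if_pos (by rw [Nat.add_assoc, hfull, card_initialStage]), hcount] at hγ
  omega

/-- The counters do not remain at the number of a stage without a perfect matching. -/
theorem IsExecution.isPerfectMatching_stage [Nonempty R] (hs : IsExecution ρ G τ s)
    (hcard : Fintype.card R = Fintype.card P)
    (hG : ∀ t, StronglyConnected (G t)) (hc : ∀ k i, IsConsistent ρ j₀ (s k i)) {K n : ℕ}
    (h : ∀ k ≥ K, ∀ i, (s k i).counter = n) :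
    IsPerfectMatching (ρ.solve (stage ρ j₀ n).1).matching := by
  classical
  by_contra hp
  -- A constant counter `n` forces the temporary counter to be `n` as well, so the robot only adds
  -- its best edge and finds the candidates incomplete.
  have hstep : ∀ k ≥ K, ∀ i,
      (∀ j ∈ inNeighborhood (G (τ k)) i, (s k j).candEdges ⊆ (s (k + 1) i).candEdges) ∧
      bestEdge ρ i (stage ρ j₀ n).2 (ρ.solve (stage ρ j₀ n).1) ⊆ (s (k + 1) i).candEdges ∧
      (s (k + 1) i).candEdges ≠ allBestEdges ρ (stage ρ j₀ n) := by
    intro k hk i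
    obtain ⟨g, hg, hpos, hneg⟩ := hs.step k i
    have h1 := hg.le_counter (self_mem_inNeighborhood _ i)
    rw [h k hk] at h1
    have h2 := hpos (by omega)
    have h3 := le_counter_localHungarian (ρ := ρ) i g
    rw [← h2, h (k + 1) (by omega)] at h3
    have hn : g.counter = n := le_antisymm h3 h1
    have hst := ((hg.isConsistent (hc k)).of_counter_eq hn).1
    rw [← hst] at hp ⊢
    obtain ⟨h4, h5⟩ := localHungarian_of_counter_eq hcard hp (i := i)
      (by rw [← h2, h (k + 1) (by omega), hn])
    rw [h2, h4]
    refine ⟨fun j hj => ?_, Finset.subset_union_right, h5⟩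
    exact (hg.candEdges_subset (hc k) (fun j _ => by rw [h k hk, hn]) hj).trans
      Finset.subset_union_left
  obtain ⟨L, hL⟩ := exists_forall_ge_eq (S := Set.univ) Set.finite_univ
    (fun k => hG (τ (K + k))) (f := fun k i => (s (K + k) i).candEdges) (fun _ _ => trivial)
    (fun k i => (hstep (K + k) (by omega) i).1 i (self_mem_inNeighborhood _ _))
    (fun k i j hj => (hstep (K + k) (by omega) i).1 j (mem_inNeighborhood.2 (Or.inr hj)))
  obtain ⟨i⟩ := ‹Nonempty R›
  -- Once all candidate sets agree, each contains every robot's best edge, so it is complete after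
  -- all. The step at `K + L` yields the states at `K + L + 1`, where agreement already holds.
  refine (hstep (K + L) (by omega) i).2.2 (Finset.Subset.antisymm ?_ ?_)
  · exact ((hc (K + L + 1) i).of_counter_eq (h _ (by omega) i)).2.1
  · refine Finset.biUnion_subset.2 fun l _ => ?_
    have h1 : (s (K + L + 1) i).candEdges = (s (K + L + 1) l).candEdges :=
      (hL (L + 1) (by omega) i l).trans (hL (L + 1) (by omega) l l).symm
    rw [h1]
    exact (hstep (K + L) (by omega) l).2.1

/-- From some time on, the counters of all robots agree, and the equality edges that belong to this
value of the counter have an optimal perfect matching. -/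
theorem IsExecution.exists_forall_assignment_eq [Nonempty R] (hs : IsExecution ρ G τ s)
    (hcard : Fintype.card R = Fintype.card P) (hG : ∀ t, StronglyConnected (G t)) :
    ∃ K M, (∀ k ≥ K, ∀ i, ρ.assignment (s k i) = M) ∧
      IsMinWeightPerfectMatching Finset.univ A.weight M := by
  -- The initial edges fix the whole sequence of stages, whatever the later communication is.
  choose j₀ hj₀ hinit using hs.init
  have hc : ∀ k i, IsConsistent ρ j₀ (s k i) := fun k => hs.isConsistent hcard (fun i => by
    obtain ⟨hE, hC, hw, -, -, -, hγ⟩ := hinit i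
    refine ⟨fun e he => ?_, Or.inl ⟨hγ, ?_, hC⟩⟩
    · obtain rfl : e = (i, j₀ i) := by simpa [hE, hC] using he
      exact hw
    · rw [hE, Finset.singleton_subset_iff]
      exact mem_initialStage.2 rfl) k
  have h0 : ∀ i, (i, j₀ i) ∈ (s 0 i).eqEdges := fun i => by simp [(hinit i).1]
  obtain ⟨b, hb⟩ := exists_stage_bound ρ hcard hj₀
  obtain ⟨K, hK⟩ := exists_forall_ge_eq (S := Set.Icc (-1 : ℤ) b) (Set.finite_Icc _ _)
    (fun k => hG (τ k)) (f := fun k i => (s k i).counter)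
    (fun k i => ⟨(hc k i).neg_one_le, by
      rcases (hc k i).stage_eq with ⟨h, -⟩ | ⟨n, h, -, -, hp⟩
      · omega
      · have := hb n hp
        omega⟩)
    (fun k i => hs.le_counter (self_mem_inNeighborhood _ _))
    (fun k i j hj => hs.le_counter (mem_inNeighborhood.2 (Or.inr hj)))
  obtain ⟨i₀⟩ := id ‹Nonempty R›
  rcases (hc K i₀).stage_eq with ⟨h, -⟩ | ⟨n, h, -, -, hn⟩
  · exact absurd (fun k hk i => (hK k hk i i₀).trans h)
      (hs.not_forall_counter_eq_neg_one hG hc h0 K)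
  have hall : ∀ k ≥ K, ∀ i, (s k i).counter = n := fun k hk i => (hK k hk i i₀).trans h
  have hp := hs.isPerfectMatching_stage hcard hG hc hall
  have hfeas := isDualFeasible_stage ρ hcard hj₀ hn
  refine ⟨K, _, fun k hk i => ?_, hp.isMinWeight hfeas.slack_nonneg fun e he =>
    hfeas.slack_eq_zero e (ρ.matching_subset _ he)⟩
  rw [Routines.assignment, ← ((hc k i).of_counter_eq (hall k hk i)).1]

/-- With a prohibitively large `𝔐`, an optimal perfect matching of the completed graph is one of
the original graph. -/
theorem AssignmentProblem.BigMProhibitive.isMinWeight (hA : A.BigMProhibitive)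
    {M M₀ : Finset (R × P)} (hM : IsMinWeightPerfectMatching Finset.univ A.weight M)
    (hM₀ : M₀ ⊆ A.edges) (hp : IsPerfectMatching M₀) :
    IsMinWeightPerfectMatching A.edges A.weight M := by
  refine ⟨?_, hM.2.1, fun M' _ hM' => hM.2.2 M' (Finset.subset_univ _) hM'⟩
  by_contra h
  exact (hA M₀ M hp hM.2.1 hM₀ h).not_ge (hM.2.2 M₀ (Finset.subset_univ _) hp)

theorem isMinWeightPerfectMatching_empty [IsEmpty R] [IsEmpty P] (w : R × P → ℝ) :
    IsMinWeightPerfectMatching Finset.univ w ∅ := by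
  refine ⟨Finset.empty_subset _, ⟨by simp [IsMatching], isEmptyElim, isEmptyElim⟩, ?_⟩
  intro M _ _
  rw [Finset.eq_empty_of_isEmpty M]

end Executions

end DistributedHungarian

theorem theorem2 {R P : Type*} [Fintype R] [Fintype P]
    (hcard : Fintype.card R = Fintype.card P)
    (A : DistributedHungarian.AssignmentProblem R P)
    (G : ℝ≥0 → Digraph R)
    (hG : ∀ t : ℝ≥0, DistributedHungarian.StronglyConnected (G t))
    (τ : ℕ → ℝ≥0) (hτ : StrictMono τ)
    (ρ : DistributedHungarian.Routines A)
    (s : ℕ → R → DistributedHungarian.State R P)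
    (hs : DistributedHungarian.IsExecution ρ G τ s) :
    ∃ Tf ∈ Set.range τ, ∃ M : Finset (R × P),
      (∀ k : ℕ, Tf ≤ τ k → ∀ i : R, ρ.assignment (s k i) = M) ∧
      DistributedHungarian.IsMinWeightPerfectMatching Finset.univ A.weight M ∧
      (A.BigMProhibitive →
        (∃ M₀ : Finset (R × P),
          M₀ ⊆ A.edges ∧ DistributedHungarian.IsPerfectMatching M₀) →
        DistributedHungarian.IsMinWeightPerfectMatching A.edges A.weight M) := by
  obtain ⟨K, M, hK, hM⟩ : ∃ K M, (∀ k ≥ K, ∀ i, ρ.assignment (s k i) = M) ∧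
      DistributedHungarian.IsMinWeightPerfectMatching Finset.univ A.weight M := by
    -- Without robots no state can supply the matching, so the empty one is given by hand.
    rcases isEmpty_or_nonempty R with hR | hR
    · have : IsEmpty P := Fintype.card_eq_zero_iff.1 (hcard ▸ Fintype.card_eq_zero)
      exact ⟨0, ∅, fun _ _ => isEmptyElim,
        DistributedHungarian.isMinWeightPerfectMatching_empty _⟩
    · exact hs.exists_forall_assignment_eq hcard hG
  exact ⟨τ K, ⟨K, rfl⟩, M, fun k hk => hK k (hτ.le_iff_le.1 hk), hM,
    fun hA ⟨M₀, hM₀, hp⟩ => hA.isMinWeight hM hM₀ hp⟩
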